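/- Let $S=(S_t)_{t\ge 0}$ be a free Brownian motion, realised on the full Fock space $\mathcal F$ over $L^2(\mathbb R_+)$ with vacuum vector $\Omega$ as $S_t=S(\mathbf 1_{[0,t]})$, where $S(h)=l(h)+l(h)^*$ for $h\in L^2_{\mathbb R}(\mathbb R_+)$ and $l(h)$ is the left creation operator. Let $W^*(\{S_t,t\ge 0\})$ be the von Neumann algebra it generates, with trace $\tau(X)=\langle X\Omega,\Omega\rangle$, and identify $X$ with $X\Omega$ in $L^2(W^*(\{S_t\}),\tau)\simeq\mathcal F$. Let $\mathcal S_{alg}$ be the unital $*$-algebra generated by all $S(h)$, and let $\nabla$ be the free Malliavin derivative: the derivation from $\mathcal S_{alg}$ to $\mathcal B_2=L^2(\mathbb R_+;L^2(\tau)\otimes L^2(\tau))$ with $\nabla S(h)=h\cdot 1\otimes 1$ and $\nabla(AB)=A\cdot\nabla B+\nabla A\cdot B$, where $A\cdot(a\otimes b)\cdot B=Aa\otimes bB$. Let $\mathbb D^{1,2}\subset L^2(\tau)$ be the domain of the closure of $\nabla$, i.e. the completion of $\mathcal S_{alg}$ for the norm $(\|Y\|_2^2+\|\nabla Y\|_{\mathcal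 B_2}^2)^{1/2}$. Then $\mathbb D^{1,2}\cap W^*(\{S_t,t\ge 0\})$ contains no non-trivial projection: for every $p=p^*=p^2\in W^*(\{S_t,t\ge 0\})$, $$p\in\mathbb D^{1,2}\iff p\in\{0,1\}.$$ More generally, the same equivalence holds for every bounded idempotent $p=p^2\in W^*(\{S_t,t\ge 0\})$, self-adjoint or not. -/

import Mathlib

open MeasureTheory TensorProduct
open scoped ENNReal NNReal InnerProductSpace

namespace WignerSpace

noncomputable section

/-! ### The full Fock space over `L²(ℝ₊)` -/

/-- Lebesgue measure on the half-line `ℝ₊ = [0, ∞)`, as a measure on `ℝ`. -/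
def halfLine : Measure ℝ := volume.restrict (Set.Ici 0)

instance : SigmaFinite halfLine := by
  unfold halfLine; infer_instance

/-- Lebesgue measure on `ℝ₊ⁿ`; for `n = 0` it is the unit mass of a one-point space. -/
abbrev halfLinePow (n : ℕ) : Measure (Fin n → ℝ) := Measure.pi fun _ => halfLine

/-- The real Hilbert space `L²_ℝ(ℝ₊)`. -/
abbrev RealL2 : Type := Lp ℝ 2 halfLine

/-- The complex Hilbert space `L²(ℝ₊)`, the complexification of `RealL2`. -/
abbrev ComplexL2 : Type := Lp ℂ 2 halfLine

/-- The inclusion of `L²_ℝ(ℝ₊)` in its complexification. -/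
def complexify (h : RealL2) : ComplexL2 := Complex.ofRealCLM.compLp h

/-- The tensors of length `n`: the `n`-th Hilbert tensor power of `L²(ℝ₊)`, realised
as `L²(ℝ₊ⁿ)`, with `h₁ ⊗ ⋯ ⊗ hₙ` the function `(t₁, …, tₙ) ↦ h₁(t₁) ⋯ hₙ(tₙ)`. -/
abbrev Chaos (n : ℕ) : Type := Lp ℂ 2 (halfLinePow n)

/-- The (completed) full Fock space `⨁ₙ L²(ℝ₊)^{⊗ n}`. -/
abbrev Fock : Type := lp Chaos 2

instance : IsProbabilityMeasure (halfLinePow 0) := by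
  rw [halfLinePow, Measure.pi_of_empty]; infer_instance

/-- The vacuum vector: the constant `1` in `L²(ℝ₊⁰) = ℂ`. -/
def vacuum : Fock :=
  lp.single 2 0 (indicatorConstLp 2 MeasurableSet.univ (measure_ne_top (halfLinePow 0) _) 1)

/-- The function `(t₀, t₁, …, tₙ) ↦ h(t₀) f(t₁, …, tₙ)`. -/
def consFun {n : ℕ} (h : ℝ → ℂ) (f : (Fin n → ℝ) → ℂ) (t : Fin (n + 1) → ℝ) : ℂ :=
  h (t 0) * f fun i => t i.succ

theorem measurePreserving_split (n : ℕ) :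
    MeasurePreserving (fun t : Fin (n + 1) → ℝ => (t 0, fun i : Fin n => t i.succ))
      (halfLinePow (n + 1)) (halfLine.prod (halfLinePow n)) :=
  measurePreserving_piFinSuccAbove (fun _ : Fin (n + 1) => halfLine) 0

theorem memLp_mul_prod {n : ℕ} (h : ComplexL2) (f : Chaos n) :
    MemLp (fun z : ℝ × (Fin n → ℝ) => h z.1 * f z.2) 2 (halfLine.prod (halfLinePow n)) := by
  have hh := Lp.memLp h
  have hf := Lp.memLp f
  have hm : AEStronglyMeasurable (fun z : ℝ × (Fin n → ℝ) => h z.1 * f z.2)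
      (halfLine.prod (halfLinePow n)) := hh.1.comp_fst.mul hf.1.comp_snd
  refine (memLp_two_iff_integrable_sq_norm hm).2 ?_
  have h1 := (memLp_two_iff_integrable_sq_norm hh.1).1 hh
  have h2 := (memLp_two_iff_integrable_sq_norm hf.1).1 hf
  refine (h1.mul_prod h2).congr (ae_of_all _ fun z => ?_)
  simp [mul_pow]

theorem memLp_consFun {n : ℕ} (h : ComplexL2) (f : Chaos n) :
    MemLp (consFun h f) 2 (halfLinePow (n + 1)) :=
  (memLp_mul_prod h f).comp_measurePreserving (measurePreserving_split n)

/-- The tensor `h ⊗ f` of length `n + 1`. -/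
def cons {n : ℕ} (h : ComplexL2) (f : Chaos n) : Chaos (n + 1) :=
  (memLp_consFun h f).toLp _

theorem coeFn_cons {n : ℕ} (h : ComplexL2) (f : Chaos n) :
    cons h f =ᵐ[halfLinePow (n + 1)] consFun h f :=
  (memLp_consFun h f).coeFn_toLp

theorem norm_sq_Lp {α : Type*} [MeasurableSpace α] {μ : Measure α} (f : Lp ℂ 2 μ) :
    ‖f‖ ^ 2 = ∫ x, ‖f x‖ ^ 2 ∂μ := by
  have h := L2.inner_def (𝕜 := ℂ) f f
  rw [inner_self_eq_norm_sq_to_K] at h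
  have h2 : (∫ x, inner ℂ (f x) (f x) ∂μ) = ((∫ x, ‖f x‖ ^ 2 ∂μ : ℝ) : ℂ) := by
    rw [← integral_complex_ofReal]
    refine integral_congr_ae (ae_of_all _ fun x => ?_)
    simp [inner_self_eq_norm_sq_to_K]
  rw [h2] at h
  exact Complex.ofReal_injective (by simpa using h)

theorem norm_cons {n : ℕ} (h : ComplexL2) (f : Chaos n) : ‖cons h f‖ = ‖h‖ * ‖f‖ := by
  have key : ‖cons h f‖ ^ 2 = (‖h‖ * ‖f‖) ^ 2 := by
    rw [mul_pow, norm_sq_Lp, norm_sq_Lp, norm_sq_Lp, ← integral_prod_mul]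
    have h1 : ∫ t, ‖cons h f t‖ ^ 2 ∂halfLinePow (n + 1)
        = ∫ t, ‖consFun h f t‖ ^ 2 ∂halfLinePow (n + 1) := by
      refine integral_congr_ae ?_
      filter_upwards [coeFn_cons h f] with t ht
      rw [ht]
    rw [h1]
    have hm := (memLp_mul_prod h f).1.norm.pow 2
    rw [← (measurePreserving_split n).map_eq] at hm ⊢
    rw [integral_map (measurePreserving_split n).measurable.aemeasurable]
    · simp [consFun, mul_pow]
    · refine hm.congr (ae_of_all _ fun z => ?_)
      simp [mul_pow]
  exact (pow_left_inj₀ (norm_nonneg _) (by positivity) two_ne_zero).1 key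

theorem ae_tail {n : ℕ} {P : (Fin n → ℝ) → Prop} (hP : ∀ᵐ s ∂halfLinePow n, P s) :
    ∀ᵐ t ∂halfLinePow (n + 1), P fun i => t i.succ := by
  have h2 : ∀ᵐ z ∂(halfLine.prod (halfLinePow n)), P z.2 :=
    Measure.quasiMeasurePreserving_snd.ae hP
  exact (measurePreserving_split n).quasiMeasurePreserving.ae h2

theorem cons_add {n : ℕ} (h : ComplexL2) (f g : Chaos n) :
    cons h (f + g) = cons h f + cons h g := by
  refine Lp.ext ?_
  filter_upwards [coeFn_cons h (f + g), coeFn_cons h f, coeFn_cons h g,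
    Lp.coeFn_add (cons h f) (cons h g), ae_tail (Lp.coeFn_add f g)] with t h1 h2 h3 h4 h5
  simp only [h1, h4, Pi.add_apply, h2, h3, consFun, h5, mul_add]

theorem cons_smul {n : ℕ} (h : ComplexL2) (c : ℂ) (f : Chaos n) :
    cons h (c • f) = c • cons h f := by
  refine Lp.ext ?_
  filter_upwards [coeFn_cons h (c • f), coeFn_cons h f,
    Lp.coeFn_smul c (cons h f), ae_tail (Lp.coeFn_smul c f)] with t h1 h2 h3 h4
  simp only [h1, h3, Pi.smul_apply, h2, consFun, h4, smul_eq_mul]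
  ring

/-- The sequence `(0, h ⊗ f₀, h ⊗ f₁, …)`. -/
def creationSeq (h : ComplexL2) (f : ∀ n, Chaos n) : ∀ n, Chaos n
  | 0 => 0
  | n + 1 => cons h (f n)

theorem hasSum_creationSeq (h : ComplexL2) (f : Fock) :
    HasSum (fun n => ‖creationSeq h f n‖ ^ (2 : ℝ≥0∞).toReal)
      (‖h‖ ^ (2 : ℝ≥0∞).toReal * ‖f‖ ^ (2 : ℝ≥0∞).toReal) := by
  have h0 : 0 < (2 : ℝ≥0∞).toReal := by norm_num
  have hs := (lp.hasSum_norm h0 f).mul_left (‖h‖ ^ (2 : ℝ≥0∞).toReal)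
  refine (hasSum_nat_add_iff' 1).1 ?_
  simpa [creationSeq, norm_cons, mul_pow] using hs

/-- The left creation operator `l(h)`. -/
def creation (h : ComplexL2) : Fock →L[ℂ] Fock :=
  LinearMap.mkContinuous
    { toFun := fun f => ⟨creationSeq h f, memℓp_gen (hasSum_creationSeq h f).summable⟩
      map_add' := fun f g => by
        ext1; funext n
        cases n with
        | zero => exact (add_zero (0 : Chaos 0)).symm
        | succ n => exact cons_add h (f n) (g n)
      map_smul' := fun c f => by
        ext1; funext n
        cases n with
        | zero => exact (smul_zero (A := Chaos 0) c).symm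
        | succ n => exact cons_smul h c (f n) }
    ‖h‖ fun f => by
      have h0 : 0 < (2 : ℝ≥0∞).toReal := by norm_num
      refine lp.norm_le_of_tsum_le h0 (by positivity) ?_
      rw [Real.mul_rpow (norm_nonneg _) (norm_nonneg _)]
      exact (hasSum_creationSeq h f).tsum_eq.le

/-- The semicircular operator `S(h) = l(h) + l(h)*`; the adjoint `l(h)*` is the left annihilation
operator. -/
def semicircular (h : RealL2) : Fock →L[ℂ] Fock :=
  creation (complexify h) + ContinuousLinearMap.adjoint (creation (complexify h))

/-! ### The von Neumann algebra of the free Brownian motion -/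

/-- The von Neumann algebra `X''` generated by a set `X` of bounded operators: the double commutant
of `X ∪ X*`. -/
def vonNeumannGenerated {H : Type*} [NormedAddCommGroup H] [InnerProductSpace ℂ H]
    [CompleteSpace H] (X : Set (H →L[ℂ] H)) : VonNeumannAlgebra H where
  toStarSubalgebra :=
    StarSubalgebra.centralizer ℂ (StarSubalgebra.centralizer ℂ X : Set (H →L[ℂ] H))
  centralizer_centralizer' := by
    change Set.centralizer (Set.centralizer
      (StarSubalgebra.centralizer ℂ (StarSubalgebra.centralizer ℂ X : Set (H →L[ℂ] H)) :
        Set (H →L[ℂ] H))) = (StarSubalgebra.centralizer ℂ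
          (StarSubalgebra.centralizer ℂ X : Set (H →L[ℂ] H)) : Set (H →L[ℂ] H))
    rw [StarSubalgebra.coe_centralizer_centralizer]
    simp

theorem halfLine_Icc_ne_top (t : ℝ) : halfLine (Set.Icc 0 t) ≠ ∞ :=
  ((Measure.restrict_apply_le _ _).trans_lt measure_Icc_lt_top).ne

/-- The free Brownian motion `S_t = S(1_{[0, t]})`, `t ≥ 0`. -/
def freeBrownianMotion (t : ℝ≥0) : Fock →L[ℂ] Fock :=
  semicircular
    (indicatorConstLp 2 (measurableSet_Icc : MeasurableSet (Set.Icc (0 : ℝ) t))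
      (halfLine_Icc_ne_top t) 1)

/-- The von Neumann algebra `W*({S_t, t ≥ 0})` generated by the free Brownian motion. -/
def freeBrownianVN : VonNeumannAlgebra Fock :=
  vonNeumannGenerated (Set.range freeBrownianMotion)

/-- The unital `*`-algebra generated by the operators `S(h)`, `h ∈ L²_ℝ(ℝ₊)`. -/
def semicircularAlg : StarSubalgebra ℂ (Fock →L[ℂ] Fock) :=
  StarAlgebra.adjoin ℂ (Set.range semicircular)

/-- `S(h)` as an element of the algebra of all the `S(h)`. -/
def semicircularElt (h : RealL2) : semicircularAlg :=
  ⟨semicircular h, StarAlgebra.subset_adjoin ℂ _ ⟨h, rfl⟩⟩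

/-- The GNS map `X ↦ XΩ`. As `τ(Y* X) = ⟨Y Ω, X Ω⟩` for the vacuum state `τ`, it is isometric for
`‖X‖₂ = τ(X* X)^{1/2}`; it realises `L²(W*({S_t}), τ)` in the Fock space. -/
def toL2 : (Fock →L[ℂ] Fock) →ₗ[ℂ] Fock where
  toFun X := X vacuum
  map_add' _ _ := rfl
  map_smul' _ _ := rfl

/-! ### The free Malliavin derivative and its domain -/

/-- The Hilbert tensor product `L²(τ) ⊗ L²(τ) = L²(τ ⊗ τᵒᵖ)`. -/
abbrev L2Tensor : Type := UniformSpace.Completion (Fock ⊗[ℂ] Fock)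

/-- The Hilbert space `ℬ₂ = L²(ℝ₊, L²(τ) ⊗ L²(τ))` of square integrable biprocesses. -/
abbrev Biprocess : Type := Lp L2Tensor 2 halfLine

/-- The algebraic biprocesses, spanned by the `h · a ⊗ b` with `h ∈ L²(ℝ₊)` and `a`, `b` in the
algebra of the `S(h)`. -/
abbrev AlgBiprocess : Type := ComplexL2 ⊗[ℂ] (semicircularAlg ⊗[ℂ] semicircularAlg)

/-- The embedding `a ⊗ b ↦ aΩ ⊗ bΩ`. -/
def tensorToL2 : semicircularAlg ⊗[ℂ] semicircularAlg →ₗ[ℂ] L2Tensor :=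
  (UniformSpace.Completion.toComplL (𝕜 := ℂ) (E := Fock ⊗[ℂ] Fock)).toLinearMap ∘ₗ
    TensorProduct.map (toL2 ∘ₗ semicircularAlg.subtype.toLinearMap)
      (toL2 ∘ₗ semicircularAlg.subtype.toLinearMap)

/-- The map `(h, v) ↦ (t ↦ h(t) v)`. -/
def scalarTimes : ComplexL2 →ₗ[ℂ] L2Tensor →ₗ[ℂ] Biprocess :=
  LinearMap.flip
    { toFun := fun v => ((ContinuousLinearMap.toSpanSingleton ℂ v).compLpL 2 halfLine).toLinearMap
      map_add' := fun v w => by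
        rw [ContinuousLinearMap.toSpanSingleton_add, ContinuousLinearMap.add_compLpL]; rfl
      map_smul' := fun c v => by
        rw [ContinuousLinearMap.toSpanSingleton_smul, ContinuousLinearMap.smul_compLpL]; rfl }

/-- The embedding of the algebraic biprocesses in `ℬ₂`, `h · a ⊗ b ↦ (t ↦ h(t) (aΩ ⊗ bΩ))`. -/
def toBiprocess : AlgBiprocess →ₗ[ℂ] Biprocess :=
  TensorProduct.lift (scalarTimes.compl₂ tensorToL2)

/-- The left action `A · (h · a ⊗ b) = h · Aa ⊗ b`. -/
def leftAct (A : semicircularAlg) : AlgBiprocess →ₗ[ℂ] AlgBiprocess :=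
  LinearMap.lTensor ComplexL2 (LinearMap.rTensor semicircularAlg (LinearMap.mulLeft ℂ A))

/-- The right action `(h · a ⊗ b) · B = h · a ⊗ bB`. -/
def rightAct (B : semicircularAlg) : AlgBiprocess →ₗ[ℂ] AlgBiprocess :=
  LinearMap.lTensor ComplexL2 (LinearMap.lTensor semicircularAlg (LinearMap.mulRight ℂ B))

/-- `IsGradient A U` says `∇A = U`: the graph of the free Malliavin derivative on the algebra of the
`S(h)`, that is, of the derivation with `∇(S(h)) = h · 1 ⊗ 1`. -/
inductive IsGradient : semicircularAlg → AlgBiprocess → Prop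
  | semicircular (h : RealL2) :
      IsGradient (semicircularElt h) (complexify h ⊗ₜ[ℂ] (1 ⊗ₜ[ℂ] 1))
  | one : IsGradient 1 0
  | add {A B : semicircularAlg} {U V : AlgBiprocess} :
      IsGradient A U → IsGradient B V → IsGradient (A + B) (U + V)
  | smul (c : ℂ) {A : semicircularAlg} {U : AlgBiprocess} :
      IsGradient A U → IsGradient (c • A) (c • U)
  | mul {A B : semicircularAlg} {U V : AlgBiprocess} :
      IsGradient A U → IsGradient B V → IsGradient (A * B) (leftAct A V + rightAct B U)

/-- The graph of the free Malliavin derivative in `L²(τ) × ℬ₂`, before taking the closure. -/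
def gradientGraph : Set (Fock × Biprocess) :=
  {z | ∃ A U, IsGradient A U ∧ z = (toL2 (A : Fock →L[ℂ] Fock), toBiprocess U)}

/-- The space `𝔻^{1,2} ⊆ L²(τ)`: the domain of the closure of the free Malliavin derivative,
equivalently the completion of the algebra for the norm `(‖Y‖₂² + ‖∇Y‖²)^{1/2}`. -/
def D12 : Set Fock := {ξ | ∃ η : Biprocess, (ξ, η) ∈ closure gradientGraph}

end

end WignerSpace

/-! ### Hilbert–Schmidt operators and traces -/

section HilbertSchmidt

open ContinuousLinearMap Filter Topology

variable {H : Type*} [NormedAddCommGroup H] [InnerProductSpace ℂ H]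
  {ι κ : Type*}

/-! The proof turns `∇` into commutators and then runs an index argument. Let `r(h)` be the right
creation operators, `P` the projection on the vacuum `Ω`, and `J` the antiunitary that reverses and
conjugates tensors. Since `[S(g), r(h)] = ⟨g, h⟩ P`, the derivations `A ↦ [A, r(h)]` encode `∇A`
once `a ⊗ b` is read as the operator `a P b`: `⟨u, [A, r(h)] v⟩ = ⟨h · u ⊗ Jv, ∇A⟩`
(`inner_rightCommutator_of_isGradient`). This passes to the closure, so for `p` in the domain
Bessel's inequality makes the `[p, r(eᵢ)]` jointly Hilbert–Schmidt, with `(eᵢ)` a Hilbert basis of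
the real space.

Let `q` be a projection with such commutators and put `rᵢ = r(eᵢ)`. As `q` commutes with `rᵢ + rᵢ*`,
each `Dᵢ = [q, rᵢ]` is self-adjoint. The `rᵢ` are isometries with orthogonal ranges filling the
complement of `Ω`. With `Q = ∑ rᵢ q rᵢ*`, the difference `A = q - Q` satisfies `A rᵢ = Dᵢ` and `AΩ =
qΩ`, hence is Hilbert–Schmidt. Two facts about `Tr A³` now collide. It is an integer, because `q`
and `Q` are projections (`exists_trace_cube_eq_intCast`). It also equals `‖qΩ‖² = τ(q)`: expanding
one factor, `Tr A³ = Tr(A q A) - Tr(A A Q)`, whose contributions on the range of `rᵢ` are `Tr(Dᵢ q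
Dᵢ)` and `Tr(Dᵢ Dᵢ q)` and cancel, leaving only the vacuum term. So `τ(q)` is `0` or `1`, and `Ω` is
separating.

For an idempotent `p`, the range projection `q` satisfies `(p + p* - 1) q = p*` with `p + p* - 1`
bounded below by `1`. The commutators of `q` are therefore controlled by those of `p` and `p*`, and
the case of projections applies to `q`. -/

theorem HilbertBasis.hasSum_norm_inner_sq (e : HilbertBasis ι ℂ H) (x : H) :
    HasSum (fun i => ‖inner ℂ (e i) x‖ ^ 2) (‖x‖ ^ 2) := by
  have h := e.hasSum_inner_mul_inner x x
  rw [inner_self_eq_norm_sq_to_K] at h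
  have h2 : (fun i => inner ℂ x (e i) * inner ℂ (e i) x)
      = fun i => (((‖inner ℂ (e i) x‖ ^ 2 : ℝ)) : ℂ) := by
    funext i
    rw [← inner_conj_symm x (e i), RCLike.conj_mul]
    norm_cast
  rw [h2] at h
  have h3 := Complex.hasSum_ofReal.1 (by simpa using h : HasSum
    (fun i => (((‖inner ℂ (e i) x‖ ^ 2 : ℝ)) : ℂ)) ((‖x‖ ^ 2 : ℝ) : ℂ))
  exact h3

/-- `X` is square summable on the Hilbert basis `e`. -/
def IsHilbertSchmidt (e : HilbertBasis ι ℂ H) (X : H →L[ℂ] H) : Prop :=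
  Summable fun i => ‖X (e i)‖ ^ 2

/-- The trace of `T` in the Hilbert basis `e` (meaningful for products of Hilbert–Schmidt
operators). -/
noncomputable def basisTrace (e : HilbertBasis ι ℂ H) (T : H →L[ℂ] H) : ℂ :=
  ∑' i, inner ℂ (e i) (T (e i))

namespace IsHilbertSchmidt

variable {e : HilbertBasis ι ℂ H} {X Y : H →L[ℂ] H}

theorem summable_prod (f : HilbertBasis κ ℂ H) (hX : IsHilbertSchmidt e X) :
    Summable fun p : ι × κ => ‖inner ℂ (f p.2) (X (e p.1))‖ ^ 2 := by
  refine (summable_prod_of_nonneg fun p => sq_nonneg _).2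
    ⟨fun i => (f.hasSum_norm_inner_sq (X (e i))).summable, ?_⟩
  exact hX.congr fun i => ((f.hasSum_norm_inner_sq (X (e i))).tsum_eq).symm

theorem mul_left (hX : IsHilbertSchmidt e X) (Y : H →L[ℂ] H) : IsHilbertSchmidt e (Y * X) := by
  refine Summable.of_nonneg_of_le (fun i => by positivity) (fun i => ?_)
    (Summable.mul_left (‖Y‖ ^ 2) hX)
  rw [← mul_pow]
  gcongr
  exact Y.le_opNorm _

theorem of_norm_le (hX : IsHilbertSchmidt e X) (h : ∀ x, ‖Y x‖ ≤ ‖X x‖) :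
    IsHilbertSchmidt e Y :=
  Summable.of_nonneg_of_le (fun i => by positivity) (fun i => by gcongr; exact h _) hX

variable [CompleteSpace H]

/-- Both sums are the total of the squared matrix entries `⟨fⱼ, X eᵢ⟩`, added by rows or by columns.
As `e` and `f` may differ, this also gives independence of the basis. -/
theorem hasSum_adjoint (f : HilbertBasis κ ℂ H) (hX : IsHilbertSchmidt e X) :
    HasSum (fun j => ‖adjoint X (f j)‖ ^ 2) (∑' i, ‖X (e i)‖ ^ 2) := by
  have h1 := hX.summable_prod f
  have h2 : ∀ j, HasSum (fun i => ‖inner ℂ (f j) (X (e i))‖ ^ 2) (‖adjoint X (f j)‖ ^ 2) := by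
    intro j
    have h := e.hasSum_norm_inner_sq (adjoint X (f j))
    simp_rw [norm_inner_symm (e _), adjoint_inner_left] at h
    exact h
  have h3 : HasSum (fun i => ‖X (e i)‖ ^ 2) (∑' p : ι × κ, ‖inner ℂ (f p.2) (X (e p.1))‖ ^ 2) :=
    h1.hasSum.prod_fiberwise fun i => f.hasSum_norm_inner_sq (X (e i))
  rw [h3.tsum_eq]
  have h4 := (Equiv.prodComm κ ι).hasSum_iff.2 h1.hasSum
  exact h4.prod_fiberwise h2

theorem adjoint' (f : HilbertBasis κ ℂ H) (hX : IsHilbertSchmidt e X) :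
    IsHilbertSchmidt f (adjoint X) :=
  (hX.hasSum_adjoint f).summable

theorem tsum_adjoint (f : HilbertBasis κ ℂ H) (hX : IsHilbertSchmidt e X) :
    ∑' j, ‖adjoint X (f j)‖ ^ 2 = ∑' i, ‖X (e i)‖ ^ 2 :=
  (hX.hasSum_adjoint f).tsum_eq

theorem mul_right (hX : IsHilbertSchmidt e X) (Y : H →L[ℂ] H) : IsHilbertSchmidt e (X * Y) := by
  have h := ((hX.adjoint' e).mul_left (adjoint Y)).adjoint' e
  rwa [show adjoint Y * adjoint X = adjoint (X * Y) from (adjoint_comp X Y).symm,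
    adjoint_adjoint] at h

omit [CompleteSpace H] in
theorem summable_inner (hX : IsHilbertSchmidt e X) (hY : IsHilbertSchmidt e Y) :
    Summable fun i => inner ℂ (X (e i)) (Y (e i)) := by
  refine Summable.of_norm_bounded (Summable.add hX hY) fun i => ?_
  have := norm_inner_le_norm (𝕜 := ℂ) (X (e i)) (Y (e i))
  nlinarith [sq_nonneg (‖X (e i)‖ - ‖Y (e i)‖), sq_nonneg (‖X (e i)‖ + ‖Y (e i)‖)]

theorem summable_trace (hX : IsHilbertSchmidt e X) (hY : IsHilbertSchmidt e Y) :
    Summable fun i => inner ℂ (e i) ((X * Y) (e i)) := by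
  simpa [← adjoint_inner_left] using (hX.adjoint' e).summable_inner hY

/-- The trace is cyclic. -/
theorem trace_mul_comm (hX : IsHilbertSchmidt e X) (hY : IsHilbertSchmidt e Y) :
    basisTrace e (X * Y) = basisTrace e (Y * X) := by
  -- The products of entries are dominated by sums of squares, so the double sum converges
  -- absolutely and may be exchanged.
  have hs : Summable fun p : ι × ι =>
      inner ℂ (e p.1) (X (e p.2)) * inner ℂ (e p.2) (Y (e p.1)) := by
    have hX2 := (Equiv.prodComm ι ι).summable_iff.2 (hX.summable_prod e)
    refine Summable.of_norm_bounded (hX2.add (hY.summable_prod e)) fun p => ?_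
    simp only [norm_mul, Function.comp, Equiv.prodComm_apply, Prod.fst_swap, Prod.snd_swap]
    nlinarith [sq_nonneg (‖inner ℂ (e p.1) (X (e p.2))‖ - ‖inner ℂ (e p.2) (Y (e p.1))‖),
      sq_nonneg (‖inner ℂ (e p.1) (X (e p.2))‖ + ‖inner ℂ (e p.2) (Y (e p.1))‖)]
  have hc := hs.tsum_comm (f := fun i j => inner ℂ (e i) (X (e j)) * inner ℂ (e j) (Y (e i)))
  have key : ∀ (X Y : H →L[ℂ] H) (i : ι),
      ∑' j, inner ℂ (e i) (X (e j)) * inner ℂ (e j) (Y (e i))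
        = inner ℂ (e i) ((X * Y) (e i)) := by
    intro X Y i
    simp_rw [← adjoint_inner_left X]
    rw [e.tsum_inner_mul_inner, adjoint_inner_left]; rfl
  simp_rw [key] at hc
  rw [basisTrace, basisTrace, ← hc]
  refine tsum_congr fun j => ?_
  rw [← key]
  exact tsum_congr fun i => mul_comm _ _

/-- The trace of a Hilbert–Schmidt projection is a natural number. -/
theorem exists_trace_eq_natCast {G : H →L[ℂ] H} (hG : IsHilbertSchmidt e G)
    (hp : IsStarProjection G) : ∃ n : ℕ, basisTrace e G = n := by
  obtain ⟨U, hU, rfl⟩ := (isStarProjection_iff_eq_starProjection).1 hp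
  have hUc : CompleteSpace U := by
    rw [← Submodule.orthogonal_orthogonal U]; infer_instance
  obtain ⟨w, g, -⟩ := exists_hilbertBasis ℂ U
  have h1 : ∀ x, HasSum (fun j => ‖inner ℂ (g j : H) x‖ ^ 2) (‖U.starProjection x‖ ^ 2) := by
    intro x
    have h := g.hasSum_norm_inner_sq (U.orthogonalProjectionOnto x)
    simp_rw [Submodule.coe_inner, Submodule.coe_norm] at h
    have h' : (fun j => ‖inner ℂ (g j : H) x‖ ^ 2) =
        fun j => ‖inner ℂ (g j : H) (U.orthogonalProjectionOnto x : H)‖ ^ 2 := by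
      funext j
      rw [← Submodule.starProjection_apply, ← Submodule.inner_starProjection_left_eq_right,
        Submodule.starProjection_eq_self_iff.2 (g j).2]
    rwa [h']
  have h2 : Summable fun p : ι × w => ‖inner ℂ (g p.2 : H) (e p.1)‖ ^ 2 := by
    refine (summable_prod_of_nonneg fun p => sq_nonneg _).2
      ⟨fun i => (h1 (e i)).summable, ?_⟩
    exact hG.congr fun i => ((h1 (e i)).tsum_eq).symm
  have h3 : HasSum (fun i => ‖U.starProjection (e i)‖ ^ 2) _ :=
    h2.hasSum.prod_fiberwise fun i => h1 (e i)
  have h4 : ∀ j, HasSum (fun i => ‖inner ℂ (g j : H) (e i)‖ ^ 2) 1 := by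
    intro j
    have := e.hasSum_norm_inner_sq (g j : H)
    have hn : ‖(g j : H)‖ = 1 := g.orthonormal.1 j
    rw [hn, one_pow] at this
    simp_rw [norm_inner_symm (e _)] at this
    exact this
  -- Summing `|⟨gⱼ, eᵢ⟩|²` over `i` first gives `1` for each `j`. Summability then forces the range
  -- to be finite dimensional, and the total is its dimension.
  have h5 : HasSum (fun _ : w => (1 : ℝ)) _ :=
    ((Equiv.prodComm w ι).hasSum_iff.2 h2.hasSum).prod_fiberwise h4
  have hfin : Finite w := by
    by_contra hinf
    rw [not_finite_iff_infinite] at hinf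
    exact one_ne_zero ((summable_const_iff _).1 h5.summable)
  have hft := Fintype.ofFinite w
  refine ⟨Fintype.card w, ?_⟩
  rw [basisTrace]
  have h6 : ∀ i, inner ℂ (e i) (U.starProjection (e i))
      = ((‖U.starProjection (e i)‖ ^ 2 : ℝ) : ℂ) := by
    intro i
    have := Submodule.inner_starProjection_left_eq_right U (e i) (U.starProjection (e i))
    rw [Submodule.starProjection_eq_self_iff.2 (Submodule.starProjection_apply_mem U _)] at this
    rw [← this, inner_self_eq_norm_sq_to_K]
    simp
  simp_rw [h6]
  rw [← Complex.ofReal_tsum, h3.tsum_eq, ← h5.tsum_eq, tsum_fintype]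
  simp

end IsHilbertSchmidt
end HilbertSchmidt

/-! ### Jointly Hilbert–Schmidt families -/

section JointlyHilbertSchmidt

open ContinuousLinearMap

variable {H : Type*} [NormedAddCommGroup H] [InnerProductSpace ℂ H] {ι κ : Type*}

/-- The family `X` is square summable on the Hilbert basis `f`. -/
def IsJointlyHilbertSchmidt (f : HilbertBasis κ ℂ H) (X : ι → H →L[ℂ] H) : Prop :=
  Summable fun x : ι × κ => ‖X x.1 (f x.2)‖ ^ 2

namespace IsJointlyHilbertSchmidt

variable {f : HilbertBasis κ ℂ H} {X Y : ι → H →L[ℂ] H}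

theorem iff_summable : IsJointlyHilbertSchmidt f X ↔
    (∀ i, IsHilbertSchmidt f (X i)) ∧ Summable fun i => ∑' k, ‖X i (f k)‖ ^ 2 :=
  summable_prod_of_nonneg (f := fun x : ι × κ => ‖X x.1 (f x.2)‖ ^ 2) fun _ => sq_nonneg _

theorem of_norm_le (hX : IsJointlyHilbertSchmidt f X) (c : ℝ)
    (h : ∀ i x, ‖Y i x‖ ≤ c * ‖X i x‖) : IsJointlyHilbertSchmidt f Y := by
  refine Summable.of_nonneg_of_le (fun i => by positivity) (fun i => ?_)
    (Summable.mul_left (c ^ 2) hX)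
  rw [← mul_pow]
  gcongr
  exact h _ _

theorem add (hX : IsJointlyHilbertSchmidt f X) (hY : IsJointlyHilbertSchmidt f Y) :
    IsJointlyHilbertSchmidt f fun i => X i + Y i := by
  refine Summable.of_nonneg_of_le (fun i => by positivity) (fun i => ?_)
    ((Summable.add hX hY).mul_left 2)
  have h : ‖(X i.1 + Y i.1) (f i.2)‖ ≤ ‖X i.1 (f i.2)‖ + ‖Y i.1 (f i.2)‖ := norm_add_le _ _
  have h' := norm_nonneg ((X i.1 + Y i.1) (f i.2))
  nlinarith [sq_nonneg (‖X i.1 (f i.2)‖ - ‖Y i.1 (f i.2)‖)]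

variable [CompleteSpace H]

theorem adjoint' (hX : IsJointlyHilbertSchmidt f X) :
    IsJointlyHilbertSchmidt f fun i => adjoint (X i) := by
  obtain ⟨h1, h2⟩ := iff_summable.1 hX
  refine iff_summable.2 ⟨fun i => (h1 i).adjoint' f, h2.congr fun i => ?_⟩
  exact ((h1 i).tsum_adjoint f).symm

theorem mul_right (hX : IsJointlyHilbertSchmidt f X) (T : H →L[ℂ] H) :
    IsJointlyHilbertSchmidt f fun i => X i * T := by
  have h : IsJointlyHilbertSchmidt f fun i => adjoint T * adjoint (X i) :=
    hX.adjoint'.of_norm_le ‖adjoint T‖ fun i x => (adjoint T).le_opNorm _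
  have h' := h.adjoint'
  have e : ∀ i, adjoint (adjoint T * adjoint (X i)) = X i * T := fun i => by
    simp only [← star_eq_adjoint, star_mul, star_star]
  simpa only [e] using h'

end IsJointlyHilbertSchmidt
end JointlyHilbertSchmidt

/-! ### The trace of the cube of a difference of projections -/

section ProjectionDifference

open ContinuousLinearMap Filter Topology

variable {R : Type*} [Ring R] {P Q : R}

/-- Both sides reduce to `P - P Q P`. Hence `P` preserves the eigenspaces of `(P - Q)²`. -/
theorem sub_sq_mul_left_of_idempotent (hP : P * P = P) (hQ : Q * Q = Q) :
    (P - Q) * (P - Q) * P = P * ((P - Q) * (P - Q)) := by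
  have hP' : ∀ x, P * (P * x) = P * x := fun x => by rw [← mul_assoc, hP]
  simp only [mul_sub, sub_mul, mul_assoc, hP, hQ, hP']
  abel

/-- With `A = P - Q` and `B = 1 - P - Q` this is `A² + B² = 1`: it bounds `A`, and makes `B` vanish
where `A² = 1`. -/
theorem sub_sq_add_sq_of_idempotent (hP : P * P = P) (hQ : Q * Q = Q) :
    (1 - P - Q) * (1 - P - Q) = 1 - (P - Q) * (P - Q) := by
  simp only [mul_sub, sub_mul, hP, hQ, one_mul, mul_one]
  abel

theorem sub_anticommute_of_idempotent (hP : P * P = P) (hQ : Q * Q = Q) :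
    (1 - P - Q) * (P - Q) = -((P - Q) * (1 - P - Q)) := by
  simp only [mul_sub, sub_mul, hP, hQ, one_mul, mul_one]
  abel

variable {H : Type*} [NormedAddCommGroup H] [InnerProductSpace ℂ H] [CompleteSpace H]
  {ι : Type*}

theorem IsSelfAdjoint.inner_left_eq {A : H →L[ℂ] H} (hA : IsSelfAdjoint A) (x y : H) :
    inner ℂ (A x) y = inner ℂ x (A y) := by
  rw [← adjoint_inner_right, hA.adjoint_eq]

theorem IsSelfAdjoint.inner_sq {A : H →L[ℂ] H} (hA : IsSelfAdjoint A) (x : H) :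
    inner ℂ x ((A * A) x) = ((‖A x‖ ^ 2 : ℝ) : ℂ) := by
  change inner ℂ x (A (A x)) = _
  rw [← hA.inner_left_eq, inner_self_eq_norm_sq_to_K]
  norm_cast

/-- The difference of two projections is a contraction. -/
theorem norm_sub_apply_le_of_isStarProjection {P Q : H →L[ℂ] H} (hP : IsStarProjection P)
    (hQ : IsStarProjection Q) (x : H) : ‖(P - Q) x‖ ≤ ‖x‖ := by
  have hA := (hP.isSelfAdjoint.sub hQ.isSelfAdjoint).inner_sq x
  have hB := (((IsSelfAdjoint.one _).sub hP.isSelfAdjoint).sub hQ.isSelfAdjoint).inner_sq x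
  rw [sub_sq_add_sq_of_idempotent hP.isIdempotentElem hQ.isIdempotentElem, sub_apply,
    inner_sub_right, hA, show (1 : H →L[ℂ] H) x = x from rfl, inner_self_eq_norm_sq_to_K] at hB
  have : ‖x‖ ^ 2 - ‖(P - Q) x‖ ^ 2 = ‖(1 - P - Q) x‖ ^ 2 :=
    Complex.ofReal_injective (by simpa using hB)
  exact abs_le_of_sq_le_sq' (by nlinarith [sq_nonneg ‖(1 - P - Q) x‖]) (norm_nonneg _) |>.2

/-- Passing from `k` to `k + 1` subtracts the trace of `Z A B²`, where `Z` is a power of `A²` and `B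
= 1 - P - Q`. As `B` anticommutes with `A` and commutes with `Z`, the products `(ZB)(BA)` and
`(BA)(ZB)` are opposite, while cyclicity gives them the same trace, so that trace is zero. -/
theorem basisTrace_pow_mul_cube (e : HilbertBasis ι ℂ H) {P Q : H →L[ℂ] H}
    (hP : IsStarProjection P) (hQ : IsStarProjection Q) (hA : IsHilbertSchmidt e (P - Q))
    (k : ℕ) :
    basisTrace e (((P - Q) * (P - Q)) ^ k * ((P - Q) * (P - Q) * (P - Q)))
      = basisTrace e ((P - Q) * (P - Q) * (P - Q)) := by
  have hB2 := sub_sq_add_sq_of_idempotent hP.isIdempotentElem.eq hQ.isIdempotentElem.eq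
  have hBA := sub_anticommute_of_idempotent hP.isIdempotentElem.eq hQ.isIdempotentElem.eq
  generalize P - Q = A at *
  generalize 1 - P - Q = B at *
  induction k with
  | zero => simp
  | succ k ih =>
    rw [← ih]
    set Z : H →L[ℂ] H := (A * A) ^ k * (A * A) with hZ
    have hAZ : A * Z = Z * A := by
      have h : Commute A (A * A) := ((Commute.refl A).mul_right (Commute.refl A))
      exact (h.pow_right k).mul_right h
    have hBAA : B * (A * A) = A * A * B := by
      rw [← mul_assoc, hBA, neg_mul, mul_assoc, hBA, mul_neg, neg_neg, mul_assoc]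
    have hBZ : B * Z = Z * B := by
      have h : Commute B (A * A) := hBAA
      exact (h.pow_right k).mul_right h
    have e1 : (A * A) ^ (k + 1) * (A * A * A) = Z * A - Z * A * (B * B) := by
      rw [hB2, mul_sub, mul_one, sub_sub_cancel, hZ, pow_succ]
      simp only [mul_assoc]
    have e2 : (A * A) ^ k * (A * A * A) = Z * A := by rw [hZ]; simp only [mul_assoc]
    have e3 : (B * A) * (Z * B) = -(Z * A * (B * B)) := by
      rw [hBA, neg_mul, mul_assoc A, ← mul_assoc B Z, hBZ, mul_assoc Z, ← mul_assoc A, hAZ]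
    have e4 : (Z * B) * (B * A) = Z * A * (B * B) := by
      rw [mul_assoc, ← mul_assoc B, hB2, sub_mul, one_mul]
      simp only [mul_sub, mul_one, mul_assoc]
    have hZHS : IsHilbertSchmidt e Z := (hA.mul_left A).mul_left _
    have hcomm := (hA.mul_left B).trace_mul_comm (hZHS.mul_right B)
    have hs1 : Summable fun i => inner ℂ (e i) ((Z * A) (e i)) := hZHS.summable_trace hA
    have hs2 : Summable fun i => inner ℂ (e i) ((Z * A * (B * B)) (e i)) := by
      rw [← e4]; exact (hZHS.mul_right B).summable_trace (hA.mul_left B)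
    have h0 : basisTrace e (Z * A * (B * B)) = 0 := by
      rw [e3, e4] at hcomm
      have hneg : basisTrace e (-(Z * A * (B * B))) = -basisTrace e (Z * A * (B * B)) := by
        simp only [basisTrace, neg_apply, inner_neg_right, tsum_neg]
      rw [hneg] at hcomm
      exact self_eq_neg.1 hcomm.symm
    rw [e1, e2]
    have hsub : basisTrace e (Z * A - Z * A * (B * B))
        = basisTrace e (Z * A) - basisTrace e (Z * A * (B * B)) := by
      simp only [basisTrace, sub_apply, inner_sub_right]
      exact hs1.tsum_sub hs2
    rw [hsub, h0, sub_zero]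

/-- An invariant subspace of a self-adjoint operator is reducing: take adjoints in `E T E = T E`. -/
theorem starProjection_commute_of_invariant {T : H →L[ℂ] H} (hT : IsSelfAdjoint T)
    (U : Submodule ℂ H) [U.HasOrthogonalProjection] (h : ∀ x ∈ U, T x ∈ U) :
    U.starProjection * T = T * U.starProjection := by
  have h1 : U.starProjection * T * U.starProjection = T * U.starProjection := by
    ext x
    exact Submodule.starProjection_eq_self_iff.2 (h _ (Submodule.starProjection_apply_mem U x))
  have h2 := congrArg star h1
  rw [star_mul, star_mul, star_mul, (isSelfAdjoint_starProjection U).star_eq, hT.star_eq,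
    ← mul_assoc] at h2
  rw [← h2, h1]

/-- If the difference `P - Q` of two projections is Hilbert–Schmidt, the trace of `(P - Q)³` is an
integer. -/
theorem exists_trace_cube_eq_intCast (e : HilbertBasis ι ℂ H) {P Q : H →L[ℂ] H}
    (hP : IsStarProjection P) (hQ : IsStarProjection Q) (hA : IsHilbertSchmidt e (P - Q)) :
    ∃ z : ℤ, basisTrace e ((P - Q) * (P - Q) * (P - Q)) = z := by
  have hpow := basisTrace_pow_mul_cube e hP hQ hA
  have hcontr := norm_sub_apply_le_of_isStarProjection hP hQ
  have hB2 := sub_sq_add_sq_of_idempotent hP.isIdempotentElem.eq hQ.isIdempotentElem.eq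
  have hPT := sub_sq_mul_left_of_idempotent hP.isIdempotentElem.eq hQ.isIdempotentElem.eq
  have hAs := hP.isSelfAdjoint.sub hQ.isSelfAdjoint
  have hBs : IsSelfAdjoint (1 - P - Q) :=
    ((IsSelfAdjoint.one _).sub hP.isSelfAdjoint).sub hQ.isSelfAdjoint
  set A := P - Q with hAdef
  set T := A * A with hTdef
  have hTs : IsSelfAdjoint T := by
    rw [hTdef, IsSelfAdjoint, star_mul, hAs.star_eq]
  have hTle : ∀ x, ‖T x‖ ≤ ‖x‖ := fun x => (hcontr _).trans (hcontr x)
  have hT1 : ‖T‖ ≤ 1 := opNorm_le_bound _ zero_le_one fun x => by simpa using hTle x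
  have hTpow : ∀ (k : ℕ) (x : H), ‖T^[k] x‖ ≤ ‖x‖ := by
    intro k x
    induction k with
    | zero => simp
    | succ k ih => rw [Function.iterate_succ_apply']; exact (hTle _).trans ih
  -- The eigenspace of `A²` for the eigenvalue `1`. The trace of `A³` will turn out to live entirely
  -- on it.
  set U := T.eqLocus (1 : H →L[ℂ] H) with hU
  have hmemU : ∀ x, x ∈ U ↔ T x = x := fun x => by rw [hU]; rfl
  set E := U.starProjection with hE
  have hEs : IsSelfAdjoint E := isSelfAdjoint_starProjection U
  have hTE : T * E = E := by
    ext x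
    exact (hmemU _).1 (Submodule.starProjection_apply_mem U x)
  have hET : E * T = E := by
    have := congrArg star hTE
    rwa [star_mul, hEs.star_eq, hTs.star_eq] at this
  have hEA : E * A = A * E := starProjection_commute_of_invariant hAs U fun x hx => by
    rw [hmemU] at hx ⊢
    change A (A (A x)) = A x
    exact congrArg A hx
  have hEP : E * P = P * E := starProjection_commute_of_invariant hP.isSelfAdjoint U fun x hx => by
    rw [hmemU] at hx ⊢
    change (T * P) x = P x
    rw [hPT]
    exact congrArg P hx
  -- On `U`, `B² = 1 - A²` vanishes, hence so does the self-adjoint `B`. Thus `Q = 1 - P` and `A =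
  -- 2P - 1` there.
  have hAE : A * E = P * E + P * E - E := by
    ext x
    have hBE : (1 - P - Q) (E x) = 0 := by
      have h := hBs.inner_sq (E x)
      have h2 : T (E x) = E x := congrArg (fun S : H →L[ℂ] H => S x) hTE
      rw [hB2, sub_apply, h2] at h
      have h3 : ((‖(1 - P - Q) (E x)‖ ^ 2 : ℝ) : ℂ) = 0 := by rw [← h]; simp
      simpa using h3
    have h4 : E x - P (E x) - Q (E x) = 0 := hBE
    change P (E x) - Q (E x) = P (E x) + P (E x) - E x
    rw [← sub_eq_zero, ← h4]
    abel
  have hEHS : IsHilbertSchmidt e E := by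
    refine hA.of_norm_le fun x => ?_
    rw [← hET]
    change ‖E (A (A x))‖ ≤ _
    exact (Submodule.norm_starProjection_apply_le U _).trans (hcontr _)
  have hPEproj : IsStarProjection (P * E) :=
    ⟨by
      change P * E * (P * E) = P * E
      rw [mul_assoc, ← mul_assoc E, hEP, mul_assoc P E, ← mul_assoc P P,
        hP.isIdempotentElem.eq, (Submodule.isIdempotentElem_starProjection U).eq], by
      rw [IsSelfAdjoint, star_mul, hEs.star_eq, hP.isSelfAdjoint.star_eq, hEP]⟩
  obtain ⟨n, hn⟩ := (hEHS.mul_left P).exists_trace_eq_natCast hPEproj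
  obtain ⟨m, hm⟩ := hEHS.exists_trace_eq_natCast (isStarProjection_starProjection)
  have htrAE : basisTrace e (A * E) = n + n - m := by
    have hs1 : Summable fun i => inner ℂ (e i) ((P * E) (e i)) := by
      have := (hEHS.mul_left P).summable_trace hEHS
      rwa [mul_assoc, (Submodule.isIdempotentElem_starProjection U).eq] at this
    have hs2 : Summable fun i => inner ℂ (e i) (E (e i)) := by
      have := hEHS.summable_trace hEHS
      rwa [(Submodule.isIdempotentElem_starProjection U).eq] at this
    rw [hAE, ← hn, ← hm]
    simp only [basisTrace, sub_apply, add_apply, inner_sub_right, inner_add_right]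
    rw [(hs1.add hs1).tsum_sub hs2, hs1.tsum_add hs1]
  refine ⟨n + n - m, ?_⟩
  push_cast
  rw [← htrAE]
  -- The mean ergodic theorem: Cesàro means of the powers of the contraction `T` converge strongly
  -- to `E`. Moving one factor `A` to the left of the inner product leaves the summable bound `‖A
  -- eᵢ‖²`.
  have hlim : Tendsto (fun N => ∑' i, inner ℂ (A (e i))
      (birkhoffAverage ℂ T _root_.id N (T (e i)))) atTop
      (𝓝 (∑' i, inner ℂ (A (e i)) (E (T (e i))))) := by
    refine tendsto_tsum_of_dominated_convergence hA (fun i => ?_) (Eventually.of_forall ?_)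
    · exact tendsto_const_nhds.inner (T.tendsto_birkhoffAverage_orthogonalProjection hT1 _)
    · intro N i
      have hav : ‖birkhoffAverage ℂ T _root_.id N (T (e i))‖ ≤ ‖A (e i)‖ := by
        rw [birkhoffAverage, birkhoffSum, norm_smul, norm_inv, RCLike.norm_natCast]
        have hsum : ‖∑ k ∈ Finset.range N, _root_.id (T^[k] (T (e i)))‖ ≤ N * ‖A (e i)‖ := by
          refine (norm_sum_le_of_le _ fun k _ => (hTpow k _).trans (hcontr _)).trans ?_
          simp
        rcases Nat.eq_zero_or_pos N with rfl | hN
        · simp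
        · rw [inv_mul_le_iff₀ (by exact_mod_cast hN)]
          exact hsum
      exact (norm_inner_le_norm _ _).trans (by rw [sq]; gcongr)
  -- Every power of `T` contributes the same trace, so the averages are constant. `N = 0` is
  -- excluded because the empty average is zero.
  have hval : ∀ N : ℕ, 0 < N → ∑' i, inner ℂ (A (e i))
      (birkhoffAverage ℂ T _root_.id N (T (e i))) = basisTrace e (A * A * A) := by
    intro N hN
    have hterm : ∀ (k : ℕ) i, inner ℂ (A (e i)) (T^[k] (T (e i)))
        = inner ℂ (e i) ((T ^ k * (A * A * A)) (e i)) := by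
      intro k i
      have hc : A * (T ^ k * T) = T ^ k * (A * A * A) := by
        have h : Commute A T := (Commute.refl A).mul_right (Commute.refl A)
        have h' : A * (T ^ k * T) = T ^ k * T * A := (h.pow_right k).mul_right h
        rw [h', hTdef]; simp only [mul_assoc]
      rw [hAs.inner_left_eq, ← hc, ← FunLike.coe_pow_eq_iterate]
      rfl
    have hsk : ∀ k : ℕ, Summable fun i => inner ℂ (e i) ((T ^ k * (A * A * A)) (e i)) := by
      intro k
      rw [← mul_assoc]
      exact ((hA.mul_left A).mul_left _).summable_trace hA
    have : ∀ i, inner ℂ (A (e i)) (birkhoffAverage ℂ T _root_.id N (T (e i)))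
        = (N : ℂ)⁻¹ * ∑ k ∈ Finset.range N, inner ℂ (e i) ((T ^ k * (A * A * A)) (e i)) := by
      intro i
      simp only [birkhoffAverage, birkhoffSum, inner_smul_right, inner_sum, _root_.id, hterm]
    simp_rw [this]
    rw [tsum_mul_left, Summable.tsum_finsetSum fun k _ => hsk k]
    have hk : ∀ k, ∑' i, inner ℂ (e i) ((T ^ k * (A * A * A)) (e i))
      = basisTrace e (A * A * A) := hpow
    simp_rw [hk]
    have : (N : ℂ) ≠ 0 := by exact_mod_cast hN.ne'
    simp [this]
  have hlim2 : Tendsto (fun N => ∑' i, inner ℂ (A (e i))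
      (birkhoffAverage ℂ T _root_.id N (T (e i)))) atTop (𝓝 (basisTrace e (A * A * A))) :=
    tendsto_const_nhds.congr' ((eventually_gt_atTop 0).mono fun N hN => (hval N hN).symm)
  rw [tendsto_nhds_unique hlim2 hlim, basisTrace]
  refine tsum_congr fun i => ?_
  rw [hAs.inner_left_eq]
  change _ = inner ℂ (e i) (A (E (e i)))
  congr 2
  exact congrArg (fun S : H →L[ℂ] H => S (e i)) hET

end ProjectionDifference

/-! ### Cuntz families: the index of a projection -/

section CuntzFamily

open ContinuousLinearMap

variable {H : Type*} [NormedAddCommGroup H] [InnerProductSpace ℂ H] [CompleteSpace H]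
  {ι κ : Type*}

/-- Isometries `r i` with orthogonal ranges that fill the orthogonal complement of the unit vector
`Ω`. -/
structure IsCuntzFamily (Ω : H) (r : ι → H →L[ℂ] H) : Prop where
  norm_vacuum : ‖Ω‖ = 1
  adjoint_mul_self (i : ι) (x : H) : adjoint (r i) (r i x) = x
  adjoint_mul_of_ne {i j : ι} (h : i ≠ j) (x : H) : adjoint (r i) (r j x) = 0
  adjoint_vacuum (i : ι) : adjoint (r i) Ω = 0
  eq_zero_of_forall (x : H) (h0 : inner ℂ Ω x = 0) (h : ∀ i, adjoint (r i) x = 0) : x = 0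

namespace IsCuntzFamily

variable {Ω : H} {r : ι → H →L[ℂ] H} (hr : IsCuntzFamily Ω r) (f : HilbertBasis κ ℂ H)
include hr

/-- The vectors `Ω` and `r i (f k)`. -/
theorem orthonormal :
    Orthonormal ℂ (Sum.elim (fun _ : Unit => Ω) fun p : ι × κ => r p.1 (f p.2)) := by
  classical
  rw [orthonormal_iff_ite]
  rintro (a | ⟨i, k⟩) (b | ⟨j, l⟩)
  · simp [inner_self_eq_norm_sq_to_K, hr.norm_vacuum]
  · simp [← adjoint_inner_left, hr.adjoint_vacuum]
  · simp [← adjoint_inner_right, hr.adjoint_vacuum]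
  · simp only [Sum.elim_inr, Sum.inr.injEq, Prod.mk.injEq]
    rw [← adjoint_inner_right]
    by_cases hij : i = j
    · subst hij
      rw [hr.adjoint_mul_self, orthonormal_iff_ite.1 f.orthonormal]
      simp
    · simp [hr.adjoint_mul_of_ne hij, hij]

/-- The Hilbert basis formed by `Ω` and the `r i (f k)`. -/
noncomputable def basis : HilbertBasis (Unit ⊕ ι × κ) ℂ H :=
  HilbertBasis.mkOfOrthogonalEqBot (hr.orthonormal f) <| by
    rw [Submodule.eq_bot_iff]
    intro x hx
    rw [Submodule.mem_orthogonal] at hx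
    refine hr.eq_zero_of_forall x (hx _ (Submodule.subset_span ⟨Sum.inl (), rfl⟩)) fun i => ?_
    have hz : ∀ k, ‖inner ℂ (f k) (adjoint (r i) x)‖ ^ 2 = 0 := fun k => by
      have h : inner ℂ (r i (f k)) x = 0 :=
        hx _ (Submodule.subset_span ⟨Sum.inr (i, k), rfl⟩)
      rw [adjoint_inner_right, h]
      simp
    have h := f.hasSum_norm_inner_sq (adjoint (r i) x)
    simp_rw [hz] at h
    exact norm_eq_zero.1 (pow_eq_zero_iff two_ne_zero |>.1 (h.unique hasSum_zero))

theorem basis_inl (u : Unit) : hr.basis f (Sum.inl u) = Ω := by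
  rw [basis, HilbertBasis.coe_mkOfOrthogonalEqBot]; rfl

theorem basis_inr (p : ι × κ) : hr.basis f (Sum.inr p) = r p.1 (f p.2) := by
  rw [basis, HilbertBasis.coe_mkOfOrthogonalEqBot]; rfl

/-- The projection `∑ᵢ rᵢ q rᵢ*`. -/
theorem exists_amplification {q : H →L[ℂ] H} (hq : IsStarProjection q) :
    ∃ Q : H →L[ℂ] H, IsStarProjection Q ∧ Q Ω = 0 ∧ ∀ i x, Q (r i x) = r i (q x) := by
  -- Taking the projection onto the closed span of the vectors `rᵢ q x` avoids the strong
  -- convergence of an infinite sum of operators.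
  set U : Submodule ℂ H :=
    (Submodule.span ℂ (Set.range fun p : ι × H => r p.1 (q p.2))).topologicalClosure with hU
  have hmem : ∀ i x, r i (q x) ∈ U := fun i x =>
    Submodule.le_topologicalClosure _ (Submodule.subset_span ⟨(i, x), rfl⟩)
  have horth : ∀ y, (∀ i x, inner ℂ (r i (q x)) y = 0) → y ∈ Uᗮ := by
    intro y hy
    rw [hU, Submodule.orthogonal_closure, Submodule.mem_orthogonal]
    intro u hu
    induction hu using Submodule.span_induction with
    | mem u hu => obtain ⟨p, rfl⟩ := hu; exact hy _ _
    | zero => simp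
    | add u v _ _ h1 h2 => rw [inner_add_left, h1, h2, add_zero]
    | smul c u _ h1 => rw [inner_smul_left, h1, mul_zero]
  have hUc : CompleteSpace U := (Submodule.isClosed_topologicalClosure _).completeSpace_coe
  refine ⟨U.starProjection, isStarProjection_starProjection, ?_, fun i x => ?_⟩
  · rw [Submodule.starProjection_apply_eq_zero_iff]
    refine horth _ fun i x => ?_
    rw [← adjoint_inner_right, hr.adjoint_vacuum, inner_zero_right]
  · have h1 : U.starProjection (r i (q x)) = r i (q x) :=
      Submodule.starProjection_eq_self_iff.2 (hmem i x)
    have h2 : U.starProjection (r i (x - q x)) = 0 := by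
      rw [Submodule.starProjection_apply_eq_zero_iff]
      refine horth _ fun j y => ?_
      rw [← adjoint_inner_right]
      by_cases hij : j = i
      · subst hij
        rw [hr.adjoint_mul_self, hq.isSelfAdjoint.inner_left_eq, map_sub]
        change inner ℂ y (q x - (q * q) x) = 0
        rw [hq.isIdempotentElem.eq, sub_self, inner_zero_right]
      · rw [hr.adjoint_mul_of_ne hij, inner_zero_right]
    rw [map_sub, map_sub, h1, sub_eq_zero] at h2
    exact h2

/-- If the commutators of a projection `q` with a Cuntz family are self-adjoint and jointly
Hilbert–Schmidt, then `⟨qΩ, Ω⟩` is an integer: it is the opposite of the index of the Fredholm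
operator from `q ⊗ 1` to `q` given by the compression of the row `(rᵢ)`. -/
theorem exists_norm_sq_eq_intCast {q : H →L[ℂ] H} (hq : IsStarProjection q)
    (hsa : ∀ i, IsSelfAdjoint (q * r i - r i * q))
    (hs : Summable fun p : ι × κ => ‖(q * r p.1 - r p.1 * q) (f p.2)‖ ^ 2) :
    ∃ z : ℤ, ‖q Ω‖ ^ 2 = z := by
  obtain ⟨Q, hQ, hQΩ, hQr⟩ := hr.exists_amplification hq
  set e := hr.basis f with he
  have hAs := hq.isSelfAdjoint.sub hQ.isSelfAdjoint
  have hAΩ : (q - Q) Ω = q Ω := by rw [sub_apply, hQΩ, sub_zero]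
  have hAr : ∀ i x, (q - Q) (r i x) = (q * r i - r i * q) x := fun i x => by
    rw [sub_apply, hQr]; rfl
  -- In the basis formed by `Ω` and the `rᵢ fₖ`, the square sum of `A` is one vacuum term plus the
  -- joint square sum of the commutators.
  have hA : IsHilbertSchmidt e (q - Q) := by
    refine Summable.sum _ ((hasSum_fintype _).summable) ?_
    refine hs.congr fun p => ?_
    simp only [Function.comp, he, basis_inr, hAr]
  obtain ⟨z, hz⟩ := exists_trace_cube_eq_intCast e hq hQ hA
  generalize hAdef : q - Q = A at *
  have hcube : A * A * A = A * (A * q) - A * (A * Q) := by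
    rw [← mul_sub, ← mul_sub, hAdef, mul_assoc]
  have hsplit : ∀ T : H →L[ℂ] H, (Summable fun i => inner ℂ (e i) ((A * T) (e i))) →
      basisTrace e (A * T) = inner ℂ (A Ω) (T Ω)
        + ∑' i, ∑' k, inner ℂ (A (r i (f k))) (T (r i (f k))) := by
    intro T hTs
    have hterm : ∀ x, inner ℂ x ((A * T) x) = inner ℂ (A x) (T x) := fun x =>
      (hAs.inner_left_eq x (T x)).symm
    rw [basisTrace, Summable.tsum_sum (hTs.comp_injective Sum.inl_injective)
      (hTs.comp_injective Sum.inr_injective)]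
    congr 1
    · simp only [he, basis_inl, hterm, tsum_fintype, Finset.univ_unique, Finset.sum_singleton]
    · have := hTs.comp_injective Sum.inr_injective
      simp only [Function.comp_def, he, basis_inr, hterm] at this ⊢
      exact this.tsum_prod
  -- Cyclicity puts `q` on the left of `A`. After this, on a vector `rᵢ fₖ` the operator `q A` is
  -- simply `q Dᵢ`, with no further commutator.
  have h1 : basisTrace e (A * (A * q)) = basisTrace e (A * (q * A)) := by
    rw [hA.trace_mul_comm (hA.mul_right q), mul_assoc]
  have hs1 : Summable fun i => inner ℂ (e i) ((A * (A * q)) (e i)) :=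
    hA.summable_trace (hA.mul_right q)
  have hs2 : Summable fun i => inner ℂ (e i) ((A * (A * Q)) (e i)) :=
    hA.summable_trace (hA.mul_right Q)
  have h2 : basisTrace e (A * A * A)
      = basisTrace e (A * (A * q)) - basisTrace e (A * (A * Q)) := by
    rw [hcube, basisTrace, basisTrace, basisTrace, ← hs1.tsum_sub hs2]
    simp only [sub_apply, inner_sub_right]
  rw [h1, hsplit _ (hA.summable_trace (hA.mul_left q)), hsplit _ hs2] at h2
  -- On the `i`-th block the two terms are `Tr(D q D)` and `Tr(D D q)`, equal by cyclicity.
  -- Self-adjointness of `D` is what allows these sums of inner products to be read as traces.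
  have h3 : ∀ i, ∑' k, inner ℂ (A (r i (f k))) ((q * A) (r i (f k)))
      = ∑' k, inner ℂ (A (r i (f k))) ((A * Q) (r i (f k))) := by
    intro i
    set D := q * r i - r i * q with hD
    have hDs : IsSelfAdjoint D := hsa i
    have hDHS : IsHilbertSchmidt f D :=
      hs.comp_injective (i := fun k => (i, k)) (Prod.mk_right_injective i)
    have hl : ∀ k, inner ℂ (A (r i (f k))) ((q * A) (r i (f k)))
        = inner ℂ (f k) ((D * (q * D)) (f k)) := fun k => by
      change inner ℂ (A (r i (f k))) (q (A (r i (f k)))) = inner ℂ (f k) (D (q (D (f k))))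
      rw [hAr, hDs.inner_left_eq]
    have hl' : ∀ k, inner ℂ (A (r i (f k))) ((A * Q) (r i (f k)))
        = inner ℂ (f k) ((D * (D * q)) (f k)) := fun k => by
      change inner ℂ (A (r i (f k))) (A (Q (r i (f k)))) = inner ℂ (f k) (D (D (q (f k))))
      rw [hQr, hAr, hAr, hDs.inner_left_eq]
    simp_rw [hl, hl']
    have := hDHS.trace_mul_comm (hDHS.mul_right q)
    rw [mul_assoc] at this
    exact this.symm
  have h4 : (A * Q) Ω = 0 := by change A (Q Ω) = 0; rw [hQΩ, map_zero]
  have h5 : inner ℂ (A Ω) ((q * A) Ω) = ((‖q Ω‖ ^ 2 : ℝ) : ℂ) := by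
    change inner ℂ (A Ω) (q (A Ω)) = _
    rw [hAΩ]
    change inner ℂ (q Ω) ((q * q) Ω) = _
    rw [hq.isIdempotentElem.eq, inner_self_eq_norm_sq_to_K]
    norm_cast
  rw [hz, h4, inner_zero_right, zero_add, h5] at h2
  simp_rw [h3] at h2
  rw [add_sub_cancel_right] at h2
  exact ⟨z, by exact_mod_cast h2.symm⟩

end IsCuntzFamily
end CuntzFamily

namespace WignerSpace

noncomputable section

/-! ### Totality of elementary tensors -/

/-- On products of finite-measure pieces, `g` is integrable and defines a complex measure vanishing
on rectangles, a generating π-system. Countably many such pieces cover the space. -/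
theorem ae_eq_zero_of_forall_integral_prod_eq_zero {α β : Type*} [MeasurableSpace α]
    [MeasurableSpace β] {μ : Measure α} {ν : Measure β} [SigmaFinite μ] [SigmaFinite ν]
    {g : α × β → ℂ} (hg : MemLp g 2 (μ.prod ν))
    (h : ∀ A B, MeasurableSet A → MeasurableSet B → μ A ≠ ∞ → ν B ≠ ∞ →
      ∫ z in A ×ˢ B, g z ∂(μ.prod ν) = 0) : g =ᵐ[μ.prod ν] 0 := by
  have key : ∀ p : ℕ × ℕ,
      ∀ᵐ z ∂((μ.prod ν).restrict (spanningSets μ p.1 ×ˢ spanningSets ν p.2)), g z = 0 := by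
    rintro ⟨m, n⟩
    set S := spanningSets μ m ×ˢ spanningSets ν n with hS
    have hSfin : (μ.prod ν) S < ∞ := by
      rw [hS, Measure.prod_prod]
      exact ENNReal.mul_lt_top (measure_spanningSets_lt_top μ m) (measure_spanningSets_lt_top ν n)
    have : IsFiniteMeasure ((μ.prod ν).restrict S) := ⟨by rwa [Measure.restrict_apply_univ]⟩
    have hint : Integrable g ((μ.prod ν).restrict S) :=
      (hg.restrict S).integrable one_le_two
    have hrect : ∀ A B, MeasurableSet A → MeasurableSet B →
        ∫ z in A ×ˢ B, g z ∂((μ.prod ν).restrict S) = 0 := by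
      intro A B hA hB
      rw [Measure.restrict_restrict (hA.prod hB), hS, Set.prod_inter_prod]
      refine h _ _ (hA.inter (measurableSet_spanningSets μ m))
        (hB.inter (measurableSet_spanningSets ν n)) ?_ ?_
      · exact ((measure_mono Set.inter_subset_right).trans_lt
          (measure_spanningSets_lt_top μ m)).ne
      · exact ((measure_mono Set.inter_subset_right).trans_lt
          (measure_spanningSets_lt_top ν n)).ne
    have hv : ((μ.prod ν).restrict S).withDensityᵥ g
        = ((μ.prod ν).restrict S).withDensityᵥ (0 : α × β → ℂ) := by
      rw [withDensityᵥ_zero]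
      refine VectorMeasure.ext_of_generateFrom _ ?_ generateFrom_prod.symm isPiSystem_prod ?_
      · rintro _ ⟨A, hA, B, hB, rfl⟩
        rw [withDensityᵥ_apply hint (MeasurableSet.prod hA hB), hrect A B hA hB]; rfl
      · rw [withDensityᵥ_apply hint MeasurableSet.univ, ← Set.univ_prod_univ,
          hrect _ _ MeasurableSet.univ MeasurableSet.univ]; rfl
    exact hint.ae_eq_of_withDensityᵥ_eq (integrable_zero _ _ _) hv
  have hcov : (⋃ p : ℕ × ℕ, spanningSets μ p.1 ×ˢ spanningSets ν p.2) = Set.univ := by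
    refine Set.eq_univ_of_forall fun z => Set.mem_iUnion.2
      ⟨(spanningSetsIndex μ z.1, spanningSetsIndex ν z.2), ?_⟩
    exact ⟨mem_spanningSetsIndex μ z.1, mem_spanningSetsIndex ν z.2⟩
  have := (ae_restrict_iUnion_iff _ _).2 key
  rwa [hcov, Measure.restrict_univ] at this

theorem ae_head {n : ℕ} {P : ℝ → Prop} (hP : ∀ᵐ s ∂halfLine, P s) :
    ∀ᵐ t ∂halfLinePow (n + 1), P (t 0) := by
  have h2 : ∀ᵐ z ∂(halfLine.prod (halfLinePow n)), P z.1 :=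
    Measure.quasiMeasurePreserving_fst.ae hP
  exact (measurePreserving_split n).quasiMeasurePreserving.ae h2

theorem coeFn_complexify (h : RealL2) : ∀ᵐ s ∂halfLine, complexify h s = (h s : ℂ) :=
  Complex.ofRealCLM.coeFn_compLp h

/-- An element of `L²(ℝ₊ⁿ⁺¹)` orthogonal to all the `h ⊗ f` vanishes. -/
theorem eq_zero_of_inner_cons {n : ℕ} (f : Chaos (n + 1))
    (h : ∀ (k : RealL2) (g : Chaos n), inner ℂ (cons (complexify k) g) f = 0) : f = 0 := by
  have hφ := measurePreserving_piFinSuccAbove (fun _ : Fin (n + 1) => halfLine) 0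
  set φ := MeasurableEquiv.piFinSuccAbove (fun _ : Fin (n + 1) => ℝ) 0 with hφdef
  have hφ' : ∀ t, φ t = (t 0, fun i : Fin n => t i.succ) := fun t => rfl
  have hg : MemLp (f ∘ φ.symm) 2 (halfLine.prod (halfLinePow n)) :=
    (Lp.memLp f).comp_measurePreserving (hφ.symm φ)
  have hz := ae_eq_zero_of_forall_integral_prod_eq_zero hg fun A B hA hB hμA hνB => by
    rw [← hφ.setIntegral_preimage_emb φ.measurableEmbedding]
    simp only [Function.comp, φ.symm_apply_apply]
    have hmeas : MeasurableSet (φ ⁻¹' (A ×ˢ B)) := φ.measurable (hA.prod hB)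
    have hfin : halfLinePow (n + 1) (φ ⁻¹' (A ×ˢ B)) ≠ ∞ := by
      rw [hφ.measure_preimage (hA.prod hB).nullMeasurableSet]
      change (halfLine.prod (halfLinePow n)) (A ×ˢ B) ≠ ∞
      rw [Measure.prod_prod]
      exact ENNReal.mul_ne_top hμA hνB
    -- A tensor of indicators is the indicator of a rectangle, so orthogonality says that the
    -- integrals of `f` over rectangles vanish. Indicators are real, hence real `k` suffice.
    have heq : cons (complexify (indicatorConstLp 2 hA hμA 1)) (indicatorConstLp 2 hB hνB 1)
        = indicatorConstLp 2 hmeas hfin (1 : ℂ) := by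
      refine Lp.ext ?_
      filter_upwards [coeFn_cons (complexify (indicatorConstLp 2 hA hμA 1))
          (indicatorConstLp 2 hB hνB 1), indicatorConstLp_coeFn (hs := hmeas) (hμs := hfin)
          (c := (1 : ℂ)) (p := 2), ae_head (coeFn_complexify (indicatorConstLp 2 hA hμA 1)),
        ae_head (indicatorConstLp_coeFn (hs := hA) (hμs := hμA) (c := (1 : ℝ)) (p := 2)),
        ae_tail (indicatorConstLp_coeFn (hs := hB) (hμs := hνB) (c := (1 : ℂ)) (p := 2))]
        with t h1 h2 h3 h4 h5
      rw [h1, h2, consFun, h3, h4, h5]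
      by_cases hA' : t 0 ∈ A <;> by_cases hB' : (fun i : Fin n => t i.succ) ∈ B <;>
        simp [Set.indicator, hφ', hA', hB']
    rw [← L2.inner_indicatorConstLp_one hmeas hfin, ← heq]
    exact h _ _
  refine Lp.ext ?_
  have := hφ.quasiMeasurePreserving.ae hz
  filter_upwards [this, Lp.coeFn_zero ℂ 2 (halfLinePow (n + 1))] with t h1 h2
  rw [h2]
  simpa using h1

/-! ### Creation operators -/

theorem inner_cons {n : ℕ} (h k : ComplexL2) (f g : Chaos n) :
    inner ℂ (cons h f) (cons k g) = inner ℂ h k * inner ℂ f g := by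
  rw [L2.inner_def, L2.inner_def, L2.inner_def, ← integral_prod_mul]
  have hφ := measurePreserving_piFinSuccAbove (fun _ : Fin (n + 1) => halfLine) 0
  have h1 := hφ.integral_comp' (g := fun z : ℝ × (Fin n → ℝ) =>
    inner ℂ (h z.1) (k z.1) * inner ℂ (f z.2) (g z.2))
  refine Eq.trans ?_ h1
  refine integral_congr_ae ?_
  filter_upwards [coeFn_cons h f, coeFn_cons k g] with t h2 h3
  rw [h2, h3]
  change inner ℂ (h (t 0) * f fun i => t i.succ) (k (t 0) * g fun i => t i.succ) =
    inner ℂ (h (t 0)) (k (t 0)) * inner ℂ (f fun i => t i.succ) (g fun i => t i.succ)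
  simp only [RCLike.inner_apply, map_mul]
  ring

theorem cons_zero {n : ℕ} (h : ComplexL2) : cons h (0 : Chaos n) = 0 := by
  simpa using cons_smul h 0 (0 : Chaos n)

theorem cons_add_left {n : ℕ} (h k : ComplexL2) (f : Chaos n) :
    cons (h + k) f = cons h f + cons k f := by
  refine Lp.ext ?_
  filter_upwards [coeFn_cons (h + k) f, coeFn_cons h f, coeFn_cons k f,
    Lp.coeFn_add (cons h f) (cons k f), ae_head (Lp.coeFn_add h k)] with t h1 h2 h3 h4 h5
  simp only [h1, h4, Pi.add_apply, h2, h3, consFun, h5, add_mul]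

theorem cons_smul_left {n : ℕ} (c : ℂ) (h : ComplexL2) (f : Chaos n) :
    cons (c • h) f = c • cons h f := by
  refine Lp.ext ?_
  filter_upwards [coeFn_cons (c • h) f, coeFn_cons h f,
    Lp.coeFn_smul c (cons h f), ae_head (Lp.coeFn_smul c h)] with t h1 h2 h3 h4
  simp only [h1, h3, Pi.smul_apply, h2, consFun, h4, smul_eq_mul]
  ring

theorem creation_apply_zero (h : ComplexL2) (x : Fock) : creation h x 0 = 0 := rfl

theorem creation_apply_succ (h : ComplexL2) (x : Fock) (n : ℕ) :
    creation h x (n + 1) = cons h (x n) := rfl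

/-- The creation operators `l(h)`, as a continuous linear function of `h`. -/
def creationL : ComplexL2 →L[ℂ] Fock →L[ℂ] Fock :=
  LinearMap.mkContinuous
    { toFun := creation
      map_add' := fun h k => by
        ext1 x; ext1; funext n
        cases n with
        | zero => exact (add_zero (0 : Chaos 0)).symm
        | succ n => exact cons_add_left h k (x n)
      map_smul' := fun c h => by
        ext1 x; ext1; funext n
        cases n with
        | zero => exact (smul_zero (A := Chaos 0) c).symm
        | succ n => exact cons_smul_left c h (x n) }
    1 fun h => by
      rw [one_mul]
      change ‖creation h‖ ≤ ‖h‖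
      unfold creation
      apply LinearMap.mkContinuous_norm_le _ (norm_nonneg h)

open ContinuousLinearMap in
theorem adjoint_creation_creation (h k : ComplexL2) (x : Fock) :
    adjoint (creation h) (creation k x) = (inner ℂ h k : ℂ) • x := by
  refine ext_inner_left ℂ fun y => ?_
  rw [adjoint_inner_right, inner_smul_right, lp.inner_eq_tsum, lp.inner_eq_tsum]
  have hs : Summable fun n => inner ℂ (creation h y n) (creation k x n) :=
    lp.summable_inner _ _
  rw [hs.tsum_eq_zero_add, ← tsum_mul_left]
  simp only [creation_apply_zero, creation_apply_succ, inner_cons, inner_zero_left, zero_add]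

open ContinuousLinearMap in
theorem adjoint_creation_vacuum (h : ComplexL2) : adjoint (creation h) vacuum = 0 := by
  refine ext_inner_left ℂ fun y => ?_
  rw [adjoint_inner_right, vacuum, lp.inner_single_right, creation_apply_zero, inner_zero_left,
    inner_zero_right]

/-- The unit vector of `L²(ℝ₊⁰)`. -/
def vacuumFun : Chaos 0 :=
  indicatorConstLp 2 MeasurableSet.univ (measure_ne_top (halfLinePow 0) _) 1

theorem coeFn_vacuumFun : ∀ᵐ t ∂halfLinePow 0, vacuumFun t = 1 := by
  filter_upwards [indicatorConstLp_coeFn (hs := MeasurableSet.univ)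
    (hμs := measure_ne_top (halfLinePow 0) _) (c := (1 : ℂ)) (p := 2)] with t ht
  rw [vacuumFun, ht]; simp

theorem vacuum_zero : vacuum 0 = vacuumFun := by
  rw [vacuum, lp.single_apply, Pi.single_eq_same]; rfl

theorem vacuum_succ (n : ℕ) : vacuum (n + 1) = 0 := by
  rw [vacuum, lp.single_apply]; simp

theorem norm_vacuum : ‖vacuum‖ = 1 := by
  rw [vacuum, lp.norm_single (by norm_num), norm_indicatorConstLp (by norm_num) (by norm_num)]
  simp

theorem apply_zero_eq_zero (x : Fock) (h0 : inner ℂ vacuum x = 0) : x 0 = 0 := by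
  rw [vacuum, lp.inner_single_left, L2.inner_indicatorConstLp_one, Measure.restrict_univ,
    integral_unique, probReal_univ, one_smul] at h0
  refine Lp.ext ?_
  filter_upwards [Lp.coeFn_zero ℂ 2 (halfLinePow 0)] with t ht
  rw [ht]
  exact (congrArg (x 0) (Subsingleton.elim t _)).trans h0

theorem creation_single (h : ComplexL2) (n : ℕ) (g : Chaos n) :
    creation h (lp.single 2 n g) = lp.single 2 (n + 1) (cons h g) := by
  ext1; funext m
  rw [lp.single_apply]
  cases m with
  | zero => rw [creation_apply_zero]; simp
  | succ m =>
    rw [creation_apply_succ, lp.single_apply]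
    by_cases hm : m = n
    · subst hm; simp
    · have hm' : m + 1 ≠ n + 1 := by omega
      rw [Pi.single_eq_of_ne hm, Pi.single_eq_of_ne hm', cons_zero]

open ContinuousLinearMap in
theorem apply_succ_eq_zero (x : Fock) (n : ℕ)
    (h : ∀ k : RealL2, adjoint (creation (complexify k)) x n = 0) : x (n + 1) = 0 := by
  refine eq_zero_of_inner_cons (x (n + 1)) fun k g => ?_
  have h1 : inner ℂ (creation (complexify k) (lp.single 2 n g)) x = 0 := by
    rw [← adjoint_inner_right, lp.inner_single_left, h k, inner_zero_right]
  rwa [creation_single, lp.inner_single_left] at h1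

open ContinuousLinearMap in
/-- A vector orthogonal to the vacuum and to the ranges of all the `l(h)` vanishes. -/
theorem eq_zero_of_adjoint_creation (x : Fock) (h0 : inner ℂ vacuum x = 0)
    (h : ∀ k : RealL2, adjoint (creation (complexify k)) x = 0) : x = 0 := by
  ext1; funext n
  cases n with
  | zero => exact apply_zero_eq_zero x h0
  | succ n => exact apply_succ_eq_zero x n fun k => by rw [h k]; rfl

/-! ### The reflection of the Fock space -/

theorem measurePreserving_rev (n : ℕ) :
    MeasurePreserving (fun (t : Fin n → ℝ) i => t (Fin.rev i)) (halfLinePow n) (halfLinePow n) := by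
  have h := measurePreserving_piCongrLeft (α := fun _ : Fin n => ℝ) (fun _ : Fin n => halfLine)
    Fin.revPerm
  convert h using 1
  funext t i
  have := Equiv.piCongrLeft_apply_apply (fun _ : Fin n => ℝ) Fin.revPerm t (Fin.rev i)
  simpa [MeasurableEquiv.coe_piCongrLeft] using this.symm

theorem ae_rev {n : ℕ} {P : (Fin n → ℝ) → Prop} (hP : ∀ᵐ s ∂halfLinePow n, P s) :
    ∀ᵐ t ∂halfLinePow n, P fun i => t (Fin.rev i) :=
  (measurePreserving_rev n).quasiMeasurePreserving.ae hP

/-- The function `(t₁, …, tₙ) ↦ conj f(tₙ, …, t₁)`. -/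
def reflect {n : ℕ} (f : Chaos n) : Chaos n :=
  star (Lp.compMeasurePreserving _ (measurePreserving_rev n) f)

theorem coeFn_reflect {n : ℕ} (f : Chaos n) :
    ∀ᵐ t ∂halfLinePow n, reflect f t = starRingEnd ℂ (f fun i => t (Fin.rev i)) := by
  filter_upwards [Lp.coeFn_star (Lp.compMeasurePreserving _ (measurePreserving_rev n) f),
    Lp.coeFn_compMeasurePreserving f (measurePreserving_rev n)] with t h1 h2
  rw [reflect, h1, Pi.star_apply, h2]; rfl

theorem reflect_add {n : ℕ} (f g : Chaos n) : reflect (f + g) = reflect f + reflect g := by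
  refine Lp.ext ?_
  filter_upwards [coeFn_reflect (f + g), coeFn_reflect f, coeFn_reflect g,
    Lp.coeFn_add (reflect f) (reflect g), ae_rev (Lp.coeFn_add f g)] with t h1 h2 h3 h4 h5
  rw [h1, h4, h5, Pi.add_apply, Pi.add_apply, map_add, h2, h3]

theorem reflect_smul {n : ℕ} (c : ℂ) (f : Chaos n) :
    reflect (c • f) = starRingEnd ℂ c • reflect f := by
  refine Lp.ext ?_
  filter_upwards [coeFn_reflect (c • f), coeFn_reflect f,
    Lp.coeFn_smul (starRingEnd ℂ c) (reflect f), ae_rev (Lp.coeFn_smul c f)] with t h1 h2 h3 h4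
  rw [h1, h3, h4, Pi.smul_apply, Pi.smul_apply, h2, smul_eq_mul, smul_eq_mul, map_mul]

theorem reflect_zero {n : ℕ} : reflect (0 : Chaos n) = 0 := by
  rw [← zero_smul ℂ (0 : Chaos n), reflect_smul, map_zero, zero_smul, zero_smul]

theorem inner_reflect {n : ℕ} (f g : Chaos n) :
    inner ℂ (reflect f) (reflect g) = (inner ℂ g f : ℂ) := by
  have hφ := measurePreserving_piCongrLeft (α := fun _ : Fin n => ℝ)
    (fun _ : Fin n => halfLine) Fin.revPerm
  have hrev : ∀ t : Fin n → ℝ,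
      MeasurableEquiv.piCongrLeft (fun _ : Fin n => ℝ) Fin.revPerm t = fun i => t (Fin.rev i) := by
    intro t
    funext i
    have := Equiv.piCongrLeft_apply_apply (fun _ : Fin n => ℝ) Fin.revPerm t (Fin.rev i)
    simpa [MeasurableEquiv.coe_piCongrLeft] using this
  have h1 := hφ.integral_comp' (g := fun t => (inner ℂ (g t) (f t) : ℂ))
  simp only [hrev] at h1
  rw [L2.inner_def, L2.inner_def]
  refine Eq.trans ?_ h1
  refine integral_congr_ae ?_
  filter_upwards [coeFn_reflect f, coeFn_reflect g] with t h2 h3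
  rw [h2, h3]
  simp [RCLike.inner_apply, mul_comm]

theorem reflect_reflect {n : ℕ} (f : Chaos n) : reflect (reflect f) = f := by
  refine Lp.ext ?_
  filter_upwards [coeFn_reflect (reflect f), ae_rev (coeFn_reflect f)] with t h1 h2
  rw [h1, h2]
  simp

theorem norm_reflect {n : ℕ} (f : Chaos n) : ‖reflect f‖ = ‖f‖ := by
  have h := inner_reflect f f
  rw [inner_self_eq_norm_sq_to_K, inner_self_eq_norm_sq_to_K] at h
  have h' : ‖reflect f‖ ^ 2 = ‖f‖ ^ 2 := by exact_mod_cast h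
  exact (pow_left_inj₀ (norm_nonneg _) (norm_nonneg _) two_ne_zero).1 h'

theorem conj_complexify (h : RealL2) :
    ∀ᵐ s ∂halfLine, starRingEnd ℂ (complexify h s) = complexify h s := by
  filter_upwards [coeFn_complexify h] with s hs
  rw [hs, Complex.conj_ofReal]

/-- Tensoring with `g` on the left commutes with tensoring with `h` on the right. -/
theorem cons_reflect_cons_reflect {n : ℕ} (g : ComplexL2) (h : RealL2) (f : Chaos n) :
    cons g (reflect (cons (complexify h) (reflect f)))
      = reflect (cons (complexify h) (reflect (cons g f))) := by
  refine Lp.ext ?_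
  filter_upwards [coeFn_cons g (reflect (cons (complexify h) (reflect f))),
    ae_tail (coeFn_reflect (cons (complexify h) (reflect f))),
    ae_tail (ae_rev (coeFn_cons (complexify h) (reflect f))),
    ae_tail (ae_rev (ae_tail (coeFn_reflect f))),
    coeFn_reflect (cons (complexify h) (reflect (cons g f))),
    ae_rev (coeFn_cons (complexify h) (reflect (cons g f))),
    ae_rev (ae_tail (coeFn_reflect (cons g f))),
    ae_rev (ae_tail (ae_rev (coeFn_cons g f)))] with t h1 h2 h3 h4 h5 h6 h7 h8
  rw [h1, h5, h6]
  simp only [consFun] at *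
  rw [h2, h3, h4, h7, h8]
  -- Conjugating the shift by the reversal turns dropping the first coordinate into dropping the
  -- last.
  have e : ∀ {m : ℕ} (i : Fin m), (Fin.rev (Fin.rev i).succ) = i.castSucc := fun i => by
    rw [Fin.rev_succ, Fin.rev_rev]
  simp only [e, map_mul, Complex.conj_conj, Fin.rev_zero, Fin.succ_last, Fin.rev_last,
    Fin.succ_castSucc]
  ring

theorem reflection_memlp (x : Fock) :
    Memℓp (fun n => reflect (x n)) (2 : ℝ≥0∞) := by
  have h := lp.memℓp x
  rw [memℓp_gen_iff (by norm_num)] at h ⊢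
  simpa only [norm_reflect] using h

/-- The antiunitary operator `J` that reverses the order of the tensors and conjugates;
`J(XΩ) = X*Ω` on the algebra of the `S(h)`. -/
def reflection : Fock →SL[starRingEnd ℂ] Fock :=
  LinearMap.mkContinuous
    { toFun := fun x => ⟨fun n => reflect (x n), reflection_memlp x⟩
      map_add' := fun x y => by
        ext1; funext n; exact reflect_add (x n) (y n)
      map_smul' := fun c x => by
        ext1; funext n; exact reflect_smul c (x n) }
    1 fun x => by
      rw [one_mul]
      refine lp.norm_le_of_forall_sum_le (by norm_num) (norm_nonneg _) fun s => ?_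
      simp only [LinearMap.coe_mk, AddHom.coe_mk, norm_reflect]
      exact lp.sum_rpow_le_norm_rpow (by norm_num) x s

theorem reflection_apply (x : Fock) (n : ℕ) : reflection x n = reflect (x n) := rfl

theorem reflection_reflection (x : Fock) : reflection (reflection x) = x := by
  ext1; funext n; exact reflect_reflect (x n)

theorem inner_reflection_reflection (x y : Fock) :
    inner ℂ (reflection x) (reflection y) = (inner ℂ y x : ℂ) := by
  rw [lp.inner_eq_tsum, lp.inner_eq_tsum]
  exact tsum_congr fun n => inner_reflect (x n) (y n)

theorem inner_reflection_left (x y : Fock) :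
    inner ℂ (reflection x) y = (inner ℂ (reflection y) x : ℂ) := by
  rw [← inner_reflection_reflection, reflection_reflection]

theorem reflection_vacuum : reflection vacuum = vacuum := by
  ext1; funext n
  rw [reflection_apply]
  cases n with
  | zero =>
    rw [vacuum_zero]
    refine Lp.ext ?_
    filter_upwards [coeFn_reflect vacuumFun, coeFn_vacuumFun, ae_rev coeFn_vacuumFun]
      with t h1 h2 h3
    rw [h1, h2, h3, map_one]
  | succ n => rw [vacuum_succ, reflect_zero]

/-- A tensor of length one is unchanged by reversal, and `h` is real. -/
theorem reflection_creation_vacuum (h : RealL2) :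
    reflection (creation (complexify h) vacuum) = creation (complexify h) vacuum := by
  ext1; funext n
  rw [reflection_apply]
  cases n with
  | zero => rw [creation_apply_zero, reflect_zero]
  | succ n =>
    rw [creation_apply_succ]
    cases n with
    | zero =>
      rw [vacuum_zero]
      refine Lp.ext ?_
      filter_upwards [coeFn_reflect (cons (complexify h) vacuumFun),
        coeFn_cons (complexify h) vacuumFun, ae_rev (coeFn_cons (complexify h) vacuumFun),
        ae_head (conj_complexify h), ae_tail coeFn_vacuumFun,
        ae_rev (ae_tail coeFn_vacuumFun)] with t h1 h2 h3 h4 h5 h6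
      rw [h1, h2, h3, consFun, consFun, h5, h6, mul_one, mul_one]
      exact h4
    | succ n =>
      rw [vacuum_succ, cons_zero, reflect_zero]

/-- The right creation operator `r(h) = J l(h) J`, `h` real. -/
def rightCreation (h : RealL2) : Fock →L[ℂ] Fock :=
  reflection.comp ((creation (complexify h)).comp reflection)

theorem rightCreation_apply (h : RealL2) (x : Fock) :
    rightCreation h x = reflection (creation (complexify h) (reflection x)) := rfl

theorem creation_rightCreation (g : ComplexL2) (h : RealL2) (x : Fock) :
    creation g (rightCreation h x) = rightCreation h (creation g x) := by
  simp only [rightCreation_apply]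
  ext1; funext n
  rcases n with _ | _ | n
  · rw [reflection_apply, creation_apply_zero, creation_apply_zero, reflect_zero]
  · rw [creation_apply_succ, reflection_apply, reflection_apply, creation_apply_zero,
      creation_apply_succ, reflection_apply, creation_apply_zero, reflect_zero, cons_zero,
      cons_zero, reflect_zero]
  · exact cons_reflect_cons_reflect g h (x n)

/-! ### Commutation relations between left and right operators -/

open ContinuousLinearMap

theorem adjoint_rightCreation_apply (h : RealL2) (x : Fock) :
    adjoint (rightCreation h) x
      = reflection (adjoint (creation (complexify h)) (reflection x)) := by
  refine ext_inner_left ℂ fun y => ?_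
  rw [adjoint_inner_right, rightCreation_apply, inner_reflection_left, ← adjoint_inner_left,
    ← inner_reflection_reflection, reflection_reflection]

theorem inner_complexify (g h : RealL2) :
    inner ℂ (complexify g) (complexify h) = ((inner ℝ g h : ℝ) : ℂ) := by
  rw [L2.inner_def, L2.inner_def, ← integral_complex_ofReal]
  refine integral_congr_ae ?_
  filter_upwards [coeFn_complexify g, coeFn_complexify h] with s h1 h2
  rw [h1, h2]
  simp [RCLike.inner_apply]

theorem adjoint_rightCreation_rightCreation (g h : RealL2) (x : Fock) :
    adjoint (rightCreation g) (rightCreation h x) = ((inner ℝ g h : ℝ) : ℂ) • x := by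
  rw [adjoint_rightCreation_apply, rightCreation_apply, reflection_reflection,
    adjoint_creation_creation, inner_complexify, map_smulₛₗ, Complex.conj_ofReal,
    reflection_reflection]

theorem rightCreation_vacuum (h : RealL2) :
    rightCreation h vacuum = creation (complexify h) vacuum := by
  rw [rightCreation_apply, reflection_vacuum, reflection_creation_vacuum]

theorem adjoint_rightCreation_vacuum (h : RealL2) : adjoint (rightCreation h) vacuum = 0 := by
  rw [adjoint_rightCreation_apply, reflection_vacuum, adjoint_creation_vacuum, map_zero]

/-- Operators that agree on the vacuum and on the ranges of the `l(k)` are equal. -/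
theorem ext_of_creation {S T : Fock →L[ℂ] Fock} (h0 : S vacuum = T vacuum)
    (h : ∀ (k : RealL2) x, S (creation (complexify k) x) = T (creation (complexify k) x)) :
    S = T := by
  rw [← sub_eq_zero, ← (adjoint (𝕜 := ℂ) (E := Fock) (F := Fock)).map_eq_zero_iff]
  ext1 y
  refine eq_zero_of_adjoint_creation _ ?_ fun k => ?_
  · rw [adjoint_inner_right, sub_apply, h0, sub_self, inner_zero_left]
  · refine ext_inner_left ℂ fun x => ?_
    rw [adjoint_inner_right, adjoint_inner_right, sub_apply, h, sub_self, inner_zero_left,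
      inner_zero_right]

/-- Removing the first letter commutes with appending a last one, except on the vacuum, where the
appended letter is itself the first. It suffices to check this on `Ω` and on the ranges of the
`l(k)`. -/
theorem adjoint_creation_rightCreation (g h : RealL2) (x : Fock) :
    adjoint (creation (complexify g)) (rightCreation h x)
      = rightCreation h (adjoint (creation (complexify g)) x)
        + ((inner ℝ g h : ℝ) : ℂ) • (inner ℂ vacuum x : ℂ) • vacuum := by
  have key : (adjoint (creation (complexify g))).comp (rightCreation h)
      = (rightCreation h).comp (adjoint (creation (complexify g)))
        + ((inner ℝ g h : ℝ) : ℂ) • (innerSL ℂ vacuum).smulRight vacuum := by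
    refine ext_of_creation ?_ fun k y => ?_
    · simp only [comp_apply, add_apply, smul_apply, smulRight_apply, innerSL_apply_apply]
      rw [rightCreation_vacuum, adjoint_creation_creation, adjoint_creation_vacuum, map_zero,
        zero_add, inner_complexify, inner_self_eq_norm_sq_to_K, norm_vacuum]
      simp
    · simp only [comp_apply, add_apply, smul_apply, smulRight_apply, innerSL_apply_apply]
      rw [← creation_rightCreation, adjoint_creation_creation, adjoint_creation_creation,
        map_smul, ← adjoint_inner_left, adjoint_creation_vacuum, inner_zero_left]
      simp
  exact congrArg (fun T : Fock →L[ℂ] Fock => T x) key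

/-- `[S(g), r(h)] = ⟨g, h⟩ P_Ω`. -/
theorem semicircular_rightCreation (g h : RealL2) (x : Fock) :
    semicircular g (rightCreation h x) = rightCreation h (semicircular g x)
        + ((inner ℝ g h : ℝ) : ℂ) • (inner ℂ vacuum x : ℂ) • vacuum := by
  simp only [semicircular, add_apply, map_add]
  rw [adjoint_creation_rightCreation, creation_rightCreation, add_assoc]

theorem adjoint_semicircular (g : RealL2) : adjoint (semicircular g) = semicircular g := by
  rw [semicircular, map_add, adjoint_adjoint, add_comm]

/-- The right semicircular operator `r(h) + r(h)*`. -/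
def rightSemicircular (h : RealL2) : Fock →L[ℂ] Fock :=
  rightCreation h + adjoint (rightCreation h)

theorem adjoint_rightSemicircular (g : RealL2) :
    adjoint (rightSemicircular g) = rightSemicircular g := by
  rw [rightSemicircular, map_add, adjoint_adjoint, add_comm]

theorem adjoint_rightCreation_semicircular (g h : RealL2) (x : Fock) :
    adjoint (rightCreation h) (semicircular g x) = semicircular g (adjoint (rightCreation h) x)
        + ((inner ℝ g h : ℝ) : ℂ) • (inner ℂ vacuum x : ℂ) • vacuum := by
  refine ext_inner_left ℂ fun y => ?_
  rw [adjoint_inner_right, ← adjoint_inner_left (semicircular g), adjoint_semicircular,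
    semicircular_rightCreation, inner_add_left, inner_add_right,
    ← adjoint_semicircular g, adjoint_inner_right, adjoint_semicircular, adjoint_inner_right]
  congr 1
  simp only [inner_smul_left, inner_smul_right, Complex.conj_ofReal, inner_conj_symm]
  ring

/-- The defects `[S(g), r(h)]` and `[S(g), r(h)*]` are opposite multiples of the vacuum projection
and cancel. -/
theorem commute_semicircular_rightSemicircular (g h : RealL2) :
    Commute (semicircular g) (rightSemicircular h) := by
  ext1 x
  change semicircular g (rightSemicircular h x) = rightSemicircular h (semicircular g x)
  simp only [rightSemicircular, add_apply, map_add]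
  rw [semicircular_rightCreation, adjoint_rightCreation_semicircular]
  abel

theorem rightSemicircular_vacuum (h : RealL2) :
    rightSemicircular h vacuum = semicircular h vacuum := by
  simp only [rightSemicircular, semicircular, add_apply]
  rw [rightCreation_vacuum, adjoint_rightCreation_vacuum, adjoint_creation_vacuum]

/-! ### The right creation operators form a Cuntz family -/

theorem isCuntzFamily_rightCreation {ι : Type*} (e : HilbertBasis ι ℝ RealL2) :
    IsCuntzFamily vacuum fun i => rightCreation (e i) where
  norm_vacuum := norm_vacuum
  adjoint_mul_self i x := by
    rw [adjoint_rightCreation_rightCreation, real_inner_self_eq_norm_sq, e.orthonormal.1 i]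
    simp
  adjoint_mul_of_ne h x := by
    rw [adjoint_rightCreation_rightCreation, e.orthonormal.2 h]
    simp
  adjoint_vacuum i := adjoint_rightCreation_vacuum (e i)
  eq_zero_of_forall x h0 h := by
    have hJ : ∀ y, reflection y = 0 → y = 0 := fun y hy => by
      rw [← reflection_reflection y, hy, map_zero]
    refine hJ x (eq_zero_of_adjoint_creation _ ?_ fun k => ?_)
    · rw [← reflection_vacuum, inner_reflection_reflection, ← inner_conj_symm, h0, map_zero]
    have hi : ∀ i, adjoint (creation (complexify (e i))) (reflection x) = 0 := fun i => by
      have := h i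
      rw [adjoint_rightCreation_apply] at this
      exact hJ _ this
    refine ext_inner_right ℂ fun z => ?_
    rw [adjoint_inner_left, inner_zero_left]
    -- Passage from the basis vectors to all real `k`: the pairing is continuous and real linear in
    -- `k`, and the real span of the basis is dense.
    let ψ : RealL2 →L[ℝ] ℂ := ((innerSL ℂ (reflection x)).restrictScalars ℝ).comp
      ((((ContinuousLinearMap.apply ℂ Fock z).comp creationL).restrictScalars ℝ).comp
        (Complex.ofRealCLM.compLpL 2 halfLine))
    have hψ : ∀ k, ψ k = inner ℂ (reflection x) (creation (complexify k) z) := fun k => rfl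
    have h0 : ψ = 0 := by
      refine ContinuousLinearMap.ext_on (s := Set.range e) ?_ ?_
      · exact Submodule.dense_iff_topologicalClosure_eq_top.2 e.dense_span
      · rintro _ ⟨i, rfl⟩
        rw [hψ, ← adjoint_inner_left, hi, inner_zero_left]; rfl
    rw [← hψ, h0]; rfl

/-! ### The vacuum is cyclic for the commutant -/

/-- The commutant of the operators `S(h)`. -/
def rightCommutant : StarSubalgebra ℂ (Fock →L[ℂ] Fock) :=
  StarSubalgebra.centralizer ℂ (Set.range semicircular)

theorem mem_rightCommutant {y : Fock →L[ℂ] Fock} :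
    y ∈ rightCommutant ↔ ∀ h, Commute (semicircular h) y := by
  rw [rightCommutant, StarSubalgebra.mem_centralizer_iff, Set.forall_mem_range]
  refine forall_congr' fun h => ?_
  rw [star_eq_adjoint, adjoint_semicircular, and_self]; rfl

theorem rightSemicircular_mem (h : RealL2) : rightSemicircular h ∈ rightCommutant :=
  mem_rightCommutant.2 fun g => commute_semicircular_rightSemicircular g h

theorem commute_of_mem_semicircularAlg {a y : Fock →L[ℂ] Fock} (ha : a ∈ semicircularAlg)
    (hy : y ∈ rightCommutant) : Commute a y := by
  have h := mem_rightCommutant.1 hy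
  have h' := mem_rightCommutant.1 (star_mem hy)
  -- Carrying `y` and its adjoint together is what closes the `star` case.
  suffices Commute a y ∧ Commute a (star y) from this.1
  induction ha using StarAlgebra.adjoin_induction with
  | mem x hx => obtain ⟨k, rfl⟩ := hx; exact ⟨h k, h' k⟩
  | algebraMap c => exact ⟨Algebra.commute_algebraMap_left c _, Algebra.commute_algebraMap_left c _⟩
  | add a b _ _ h1 h2 => exact ⟨h1.1.add_left h2.1, h1.2.add_left h2.2⟩
  | mul a b _ _ h1 h2 => exact ⟨h1.1.mul_left h2.1, h1.2.mul_left h2.2⟩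
  | star a _ h1 => exact
    ⟨by simpa using Commute.star_star h1.2, Commute.star_star h1.1⟩

/-- The `S_t` are among the `S(h)`, so the commutant of all the `S(h)` lies in that of the `S_t`,
with which `p` commutes. This inclusion is enough; density of step functions is not needed. -/
theorem commute_of_mem_freeBrownianVN {p y : Fock →L[ℂ] Fock} (hp : p ∈ freeBrownianVN)
    (hy : y ∈ rightCommutant) : Commute p y := by
  have hp' : p ∈ StarSubalgebra.centralizer ℂ
    (StarSubalgebra.centralizer ℂ (Set.range freeBrownianMotion) : Set (Fock →L[ℂ] Fock)) := hp
  have hy' : y ∈ StarSubalgebra.centralizer ℂ (Set.range freeBrownianMotion) := by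
    refine StarSubalgebra.centralizer_le ℂ _ _ ?_ hy
    rintro _ ⟨t, rfl⟩
    exact ⟨_, rfl⟩
  exact ((StarSubalgebra.mem_centralizer_iff ℂ).1 hp' y hy').1.symm

/-- The elementary tensors, as vectors of the Fock space. -/
def elemTensor : List RealL2 → Fock
  | [] => vacuum
  | h :: l => rightCreation h (elemTensor l)

/-- The Wick recursion for the right semicircular operators `W(h) = r(h) + r(h)*`: applying `W(h)`
to a tensor ending in `k` adds the letter `h`, plus `⟨h, k⟩` times the tensor with `k` removed. The
recursion has two steps, hence the conjunction over two consecutive lengths. -/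
theorem exists_rightCommutant_apply_vacuum (l : List RealL2) :
    (∃ y ∈ rightCommutant, y vacuum = elemTensor l) ∧
      ∀ h, ∃ y ∈ rightCommutant, y vacuum = elemTensor (h :: l) := by
  induction l with
  | nil =>
    refine ⟨⟨1, one_mem _, rfl⟩, fun h => ⟨_, rightSemicircular_mem h, ?_⟩⟩
    rw [rightSemicircular, add_apply, adjoint_rightCreation_vacuum, add_zero]
    rfl
  | cons k l ih =>
    refine ⟨ih.2 k, fun h => ?_⟩
    obtain ⟨y, hy, hyv⟩ := ih.1
    obtain ⟨z, hz, hzv⟩ := ih.2 k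
    refine ⟨rightSemicircular h * z - ((inner ℝ h k : ℝ) : ℂ) • y,
      sub_mem (mul_mem (rightSemicircular_mem h) hz) (SMulMemClass.smul_mem _ hy), ?_⟩
    change rightSemicircular h (z vacuum) - ((inner ℝ h k : ℝ) : ℂ) • y vacuum = _
    rw [hzv, hyv]
    change rightCreation h _ + adjoint (rightCreation h) (rightCreation k (elemTensor l)) - _ = _
    rw [adjoint_rightCreation_rightCreation, add_sub_cancel_right]; rfl

/-- Induction on the degree, stripping the last letter with `r(k)*`. The reflection transports this
to the criterion proved for the left creation operators. -/
theorem eq_zero_of_inner_elemTensor (x : Fock) (h : ∀ l, inner ℂ (elemTensor l) x = 0) :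
    x = 0 := by
  suffices ∀ (n : ℕ) (x : Fock), (∀ l, inner ℂ (elemTensor l) x = 0) → x n = 0 by
    ext1; funext n; exact this n x h
  intro n
  induction n with
  | zero => exact fun x h => apply_zero_eq_zero x (h [])
  | succ n ih =>
    intro x h
    have hr : ∀ m, reflection x m = 0 ↔ x m = 0 := fun m => by
      rw [reflection_apply]
      refine ⟨fun h => ?_, fun h => by rw [h, reflect_zero]⟩
      rw [← reflect_reflect (x m), h, reflect_zero]
    rw [← hr]
    refine apply_succ_eq_zero _ n fun k => ?_
    have h1 := ih (adjoint (rightCreation k) x) fun l => by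
      rw [adjoint_inner_right]; exact h (k :: l)
    rw [adjoint_rightCreation_apply, reflection_apply] at h1
    rw [← reflect_reflect (adjoint (creation (complexify k)) (reflection x) n), h1, reflect_zero]

theorem ext_elemTensor {S T : Fock →L[ℂ] Fock} (h : ∀ l, S (elemTensor l) = T (elemTensor l)) :
    S = T := by
  rw [← sub_eq_zero, ← (adjoint (𝕜 := ℂ) (E := Fock) (F := Fock)).map_eq_zero_iff]
  ext1 y
  refine eq_zero_of_inner_elemTensor _ fun l => ?_
  rw [adjoint_inner_right, sub_apply, h, sub_self, inner_zero_left]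

/-- The vacuum is separating. -/
theorem eq_zero_of_apply_vacuum {q : Fock →L[ℂ] Fock}
    (hq : ∀ y ∈ rightCommutant, Commute q y) (h : q vacuum = 0) : q = 0 := by
  refine ext_elemTensor fun l => ?_
  obtain ⟨y, hy, hyv⟩ := (exists_rightCommutant_apply_vacuum l).1
  rw [← hyv]
  change (q * y) vacuum = 0
  rw [(hq y hy).eq]
  change y (q vacuum) = 0
  rw [h, map_zero]

/-! ### The reflection on the algebra of the `S(h)` -/

theorem reflection_semicircular (h : RealL2) (x : Fock) :
    reflection (semicircular h x) = rightSemicircular h (reflection x) := by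
  simp only [semicircular, rightSemicircular, add_apply, map_add]
  rw [rightCreation_apply, adjoint_rightCreation_apply, reflection_reflection]

/-- The operator `J a J`. -/
def conjReflection (a : Fock →L[ℂ] Fock) : Fock →L[ℂ] Fock :=
  reflection.comp (a.comp reflection)

theorem conjReflection_apply (a : Fock →L[ℂ] Fock) (x : Fock) :
    conjReflection a x = reflection (a (reflection x)) := rfl

/-- `J S(h) J` is the right semicircular operator, and `a ↦ J a J` respects sums, products and
adjoints. -/
theorem conjReflection_mem {a : Fock →L[ℂ] Fock} (ha : a ∈ semicircularAlg) :
    conjReflection a ∈ rightCommutant := by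
  induction ha using StarAlgebra.adjoin_induction with
  | mem x hx =>
    obtain ⟨h, rfl⟩ := hx
    convert rightSemicircular_mem h using 1
    ext1 x
    rw [conjReflection_apply, reflection_semicircular, reflection_reflection]
  | algebraMap c =>
    convert algebraMap_mem rightCommutant (starRingEnd ℂ c) using 1
    ext1 x
    rw [conjReflection_apply, Algebra.algebraMap_eq_smul_one, Algebra.algebraMap_eq_smul_one]
    change reflection (c • reflection x) = starRingEnd ℂ c • x
    rw [map_smulₛₗ, reflection_reflection]
  | add a b _ _ h1 h2 =>
    convert add_mem h1 h2 using 1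
    ext1 x
    simp only [add_apply, conjReflection_apply, map_add]
  | mul a b _ _ h1 h2 =>
    convert mul_mem h1 h2 using 1
    ext1 x
    change _ = conjReflection a (conjReflection b x)
    simp only [conjReflection_apply, reflection_reflection]; rfl
  | star a _ h1 =>
    convert star_mem h1 using 1
    ext1 x
    refine ext_inner_left ℂ fun y => ?_
    rw [star_eq_adjoint, star_eq_adjoint, adjoint_inner_right, conjReflection_apply,
      conjReflection_apply, inner_reflection_left, ← adjoint_inner_left,
      ← inner_reflection_reflection, reflection_reflection]

/-- `J(aΩ) = a*Ω`. -/
theorem reflection_apply_vacuum {a : Fock →L[ℂ] Fock} (ha : a ∈ semicircularAlg) :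
    reflection (a vacuum) = adjoint a vacuum := by
  induction ha using StarAlgebra.adjoin_induction with
  | mem x hx =>
    obtain ⟨h, rfl⟩ := hx
    rw [reflection_semicircular, reflection_vacuum, adjoint_semicircular, rightSemicircular_vacuum]
  | algebraMap c =>
    rw [← star_eq_adjoint, ← algebraMap_star_comm, Algebra.algebraMap_eq_smul_one,
      Algebra.algebraMap_eq_smul_one]
    change reflection (c • vacuum) = starRingEnd ℂ c • vacuum
    rw [map_smulₛₗ, reflection_vacuum]
  | add a b _ _ h1 h2 => simp only [add_apply, map_add, h1, h2]
  | mul a b ha hb h1 h2 =>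
    -- Evaluate `b* (J a J) = (J a J) b*` at the vacuum: the left side becomes `b* a* Ω`, the right
    -- side `J(a b Ω)`.
    have hc : Commute (star b) (conjReflection a) :=
      commute_of_mem_semicircularAlg (star_mem hb) (conjReflection_mem ha)
    have hc' := congrArg (fun T : Fock →L[ℂ] Fock => T vacuum) hc.eq
    change star b (reflection (a (reflection vacuum)))
      = reflection (a (reflection (star b vacuum))) at hc'
    rw [reflection_vacuum, h1, star_eq_adjoint, ← h2, reflection_reflection] at hc'
    change reflection (a (b vacuum)) = _
    rw [← hc', ← star_eq_adjoint, ← star_eq_adjoint, ← star_eq_adjoint, star_mul]; rfl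
  | star a _ h1 =>
    rw [star_eq_adjoint, ← h1, reflection_reflection, adjoint_adjoint]

/-! ### The gradient as a commutator -/

theorem inner_scalarTimes (h g : ComplexL2) (v w : L2Tensor) :
    inner ℂ (scalarTimes h v) (scalarTimes g w) = inner ℂ h g * inner ℂ v w := by
  have hc : ∀ (h : ComplexL2) (v : L2Tensor), ∀ᵐ t ∂halfLine, scalarTimes h v t = h t • v :=
    fun h v => (ContinuousLinearMap.toSpanSingleton ℂ v).coeFn_compLp h
  rw [L2.inner_def, L2.inner_def, ← integral_mul_const]
  refine integral_congr_ae ?_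
  filter_upwards [hc h v, hc g w] with t h1 h2
  rw [h1, h2, inner_smul_left, inner_smul_right, RCLike.inner_apply]
  ring

/-- The biprocess `h · u ⊗ v`. -/
def elemBiprocess (h : RealL2) (u v : Fock) : Biprocess :=
  scalarTimes (complexify h) ((u ⊗ₜ[ℂ] v : Fock ⊗[ℂ] Fock) : L2Tensor)

theorem inner_elemBiprocess (g h : RealL2) (u v u' v' : Fock) :
    inner ℂ (elemBiprocess g u v) (elemBiprocess h u' v')
      = ((inner ℝ g h : ℝ) : ℂ) * (inner ℂ u u' * inner ℂ v v') := by
  rw [elemBiprocess, elemBiprocess, inner_scalarTimes, inner_complexify,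
    UniformSpace.Completion.inner_coe, TensorProduct.inner_tmul]

theorem continuous_elemBiprocess (h : RealL2) (u : Fock) : Continuous (elemBiprocess h u) := by
  have h1 : Continuous (scalarTimes (complexify h)) := by
    refine AddMonoidHomClass.continuous_of_bound (scalarTimes (complexify h))
      ‖complexify h‖ fun v => ?_
    have hsq : ‖scalarTimes (complexify h) v‖ ^ 2 = (‖complexify h‖ * ‖v‖) ^ 2 := by
      have := inner_scalarTimes (complexify h) (complexify h) v v
      simp only [inner_self_eq_norm_sq_to_K] at this
      rw [mul_pow]
      exact_mod_cast this
    exact ((pow_left_inj₀ (norm_nonneg _) (by positivity) two_ne_zero).1 hsq).le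
  exact h1.comp ((UniformSpace.Completion.continuous_coe _).comp (by fun_prop))

theorem toBiprocess_tmul (g : ComplexL2) (a b : semicircularAlg) :
    toBiprocess (g ⊗ₜ[ℂ] (a ⊗ₜ[ℂ] b))
      = scalarTimes g (((a : Fock →L[ℂ] Fock) vacuum ⊗ₜ[ℂ] (b : Fock →L[ℂ] Fock) vacuum :
          Fock ⊗[ℂ] Fock) : L2Tensor) := rfl

/-- The right side contains the coefficient `⟨u, a P b v⟩`, where `P` is the vacuum projection.
Reflecting `v` is what moves `b` onto it: `⟨Jv, bΩ⟩ = ⟨b*Ω, v⟩ = ⟨Ω, b v⟩`. -/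
theorem inner_elemBiprocess_toBiprocess_tmul (h : RealL2) (u v : Fock) (g : ComplexL2)
    (a b : semicircularAlg) :
    inner ℂ (elemBiprocess h u (reflection v)) (toBiprocess (g ⊗ₜ[ℂ] (a ⊗ₜ[ℂ] b)))
      = inner ℂ (complexify h) g * (inner ℂ u ((a : Fock →L[ℂ] Fock) vacuum)
          * inner ℂ vacuum ((b : Fock →L[ℂ] Fock) v)) := by
  rw [toBiprocess_tmul, elemBiprocess, inner_scalarTimes, UniformSpace.Completion.inner_coe,
    TensorProduct.inner_tmul, inner_reflection_left, reflection_apply_vacuum b.2,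
    adjoint_inner_left]

theorem induction_algBiprocess {P : AlgBiprocess → Prop} (U : AlgBiprocess) (h0 : P 0)
    (ht : ∀ (g : ComplexL2) (a b : semicircularAlg), P (g ⊗ₜ[ℂ] (a ⊗ₜ[ℂ] b)))
    (ha : ∀ U V, P U → P V → P (U + V)) : P U := by
  induction U using TensorProduct.induction_on with
  | zero => exact h0
  | tmul g x =>
    induction x using TensorProduct.induction_on with
    | zero => rw [tmul_zero]; exact h0
    | tmul a b => exact ht g a b
    | add x y hx hy => rw [tmul_add]; exact ha _ _ hx hy
  | add x y hx hy => exact ha _ _ hx hy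

/-- When `a ⊗ b` is read as `a P b`, the left action is composition with `A` on the left. The right
action is likewise composition with `B` on the right. -/
theorem inner_elemBiprocess_leftAct (h : RealL2) (u v : Fock) (A : semicircularAlg)
    (U : AlgBiprocess) :
    inner ℂ (elemBiprocess h u (reflection v)) (toBiprocess (leftAct A U))
      = inner ℂ (elemBiprocess h (adjoint (A : Fock →L[ℂ] Fock) u) (reflection v))
          (toBiprocess U) := by
  induction U using induction_algBiprocess with
  | h0 => simp
  | ht g a b =>
    have : leftAct A (g ⊗ₜ[ℂ] (a ⊗ₜ[ℂ] b)) = g ⊗ₜ[ℂ] ((A * a) ⊗ₜ[ℂ] b) := rfl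
    rw [this, inner_elemBiprocess_toBiprocess_tmul, inner_elemBiprocess_toBiprocess_tmul,
      adjoint_inner_left]
    rfl
  | ha U V hU hV => simp only [map_add, inner_add_right, hU, hV]

theorem inner_elemBiprocess_rightAct (h : RealL2) (u v : Fock) (B : semicircularAlg)
    (U : AlgBiprocess) :
    inner ℂ (elemBiprocess h u (reflection v)) (toBiprocess (rightAct B U))
      = inner ℂ (elemBiprocess h u (reflection ((B : Fock →L[ℂ] Fock) v))) (toBiprocess U) := by
  induction U using induction_algBiprocess with
  | h0 => simp
  | ht g a b =>
    have : rightAct B (g ⊗ₜ[ℂ] (a ⊗ₜ[ℂ] b)) = g ⊗ₜ[ℂ] (a ⊗ₜ[ℂ] (b * B)) := rfl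
    rw [this, inner_elemBiprocess_toBiprocess_tmul, inner_elemBiprocess_toBiprocess_tmul]
    rfl
  | ha U V hU hV => simp only [map_add, inner_add_right, hU, hV]

/-- The commutator `[p, r(h)]`. -/
def rightCommutator (p : Fock →L[ℂ] Fock) (h : RealL2) : Fock →L[ℂ] Fock :=
  p * rightCreation h - rightCreation h * p

theorem rightCommutator_apply (p : Fock →L[ℂ] Fock) (h : RealL2) (v : Fock) :
    rightCommutator p h v = p (rightCreation h v) - rightCreation h (p v) := rfl

/-- The matrix coefficients of the operators `[A, r(h)]` are those of `∇A`. -/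
theorem inner_rightCommutator_of_isGradient {A : semicircularAlg} {U : AlgBiprocess}
    (hAU : IsGradient A U) (h : RealL2) (u v : Fock) :
    inner ℂ u (rightCommutator (A : Fock →L[ℂ] Fock) h v)
      = inner ℂ (elemBiprocess h u (reflection v)) (toBiprocess U) := by
  induction hAU generalizing u v with
  | semicircular g =>
    rw [inner_elemBiprocess_toBiprocess_tmul, rightCommutator_apply]
    change inner ℂ u (semicircular g (rightCreation h v) - rightCreation h (semicircular g v))
      = inner ℂ (complexify h) (complexify g) * (inner ℂ u vacuum * inner ℂ vacuum v)
    rw [semicircular_rightCreation, add_sub_cancel_left, inner_smul_right, inner_smul_right,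
      inner_complexify, real_inner_comm, mul_comm (inner ℂ vacuum v)]
  | one =>
    rw [map_zero, inner_zero_right, rightCommutator_apply]
    change inner ℂ u (rightCreation h v - rightCreation h v) = 0
    rw [sub_self, inner_zero_right]
  | @add A B U V _ _ h1 h2 =>
    rw [map_add, inner_add_right, ← h1, ← h2, ← inner_add_right]
    congr 1
    simp only [rightCommutator_apply]
    change (A : Fock →L[ℂ] Fock) _ + (B : Fock →L[ℂ] Fock) _
      - rightCreation h ((A : Fock →L[ℂ] Fock) v + (B : Fock →L[ℂ] Fock) v) = _
    rw [map_add]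
    abel
  | @smul c A U _ h1 =>
    rw [map_smul, inner_smul_right, ← h1, ← inner_smul_right]
    congr 1
    simp only [rightCommutator_apply]
    change c • (A : Fock →L[ℂ] Fock) _ - rightCreation h (c • (A : Fock →L[ℂ] Fock) v) = _
    rw [map_smul, smul_sub]
  -- Both sides obey the Leibniz rule: `[AB, r] = A [B, r] + [A, r] B`.
  | @mul A B U V _ _ h1 h2 =>
    rw [map_add, inner_add_right, inner_elemBiprocess_leftAct, inner_elemBiprocess_rightAct,
      ← h1, ← h2, adjoint_inner_left, ← inner_add_right]
    congr 1
    simp only [rightCommutator_apply, map_sub]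
    change (A : Fock →L[ℂ] Fock) ((B : Fock →L[ℂ] Fock) _)
      - rightCreation h ((A : Fock →L[ℂ] Fock) ((B : Fock →L[ℂ] Fock) v)) = _
    abel

/-- For `p` in the domain of the closed gradient, the operators `[p, r(h)]` have the matrix
coefficients of a biprocess. -/
theorem exists_inner_rightCommutator_eq {p : Fock →L[ℂ] Fock}
    (hp : ∀ y ∈ rightCommutant, Commute p y) (hD : toL2 p ∈ D12) :
    ∃ η : Biprocess, ∀ (h : RealL2) (u v : Fock),
      inner ℂ u (rightCommutator p h v) = inner ℂ (elemBiprocess h u (reflection v)) η := by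
  obtain ⟨η, hη⟩ := hD
  refine ⟨η, fun h u => ?_⟩
  obtain ⟨z, hz, hlim⟩ := mem_closure_iff_seq_limit.1 hη
  choose A U hAU hzA using hz
  have hlim1 : Filter.Tendsto (fun n => (A n : Fock →L[ℂ] Fock) vacuum) Filter.atTop
      (nhds (p vacuum)) := by
    have := (continuous_fst.tendsto _).comp hlim
    refine this.congr fun n => ?_
    simp only [Function.comp, hzA]; rfl
  have hlim2 : Filter.Tendsto (fun n => toBiprocess (U n)) Filter.atTop (nhds η) := by
    have := (continuous_snd.tendsto _).comp hlim
    refine this.congr fun n => ?_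
    simp only [Function.comp, hzA]
  -- Convergence is known only on the vacuum. Writing an elementary tensor as `yΩ` with `y` in the
  -- commutant transfers it there.
  have hstrong : ∀ l, Filter.Tendsto (fun n => (A n : Fock →L[ℂ] Fock) (elemTensor l))
      Filter.atTop (nhds (p (elemTensor l))) := by
    intro l
    obtain ⟨y, hy, hyv⟩ := (exists_rightCommutant_apply_vacuum l).1
    have hc : ∀ a : Fock →L[ℂ] Fock, Commute a y → a (elemTensor l) = y (a vacuum) :=
      fun a ha => by
        rw [← hyv]; exact congrArg (fun T : Fock →L[ℂ] Fock => T vacuum) ha.eq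
    rw [hc p (hp y hy)]
    simp_rw [hc _ (commute_of_mem_semicircularAlg (A _).2 hy)]
    exact (y.continuous.tendsto _).comp hlim1
  have hbasic : ∀ l, inner ℂ u (rightCommutator p h (elemTensor l))
      = inner ℂ (elemBiprocess h u (reflection (elemTensor l))) η := by
    intro l
    refine tendsto_nhds_unique (f := fun n => inner ℂ u
      (rightCommutator (A n : Fock →L[ℂ] Fock) h (elemTensor l))) (l := Filter.atTop) ?_ ?_
    · simp only [rightCommutator_apply]
      exact tendsto_const_nhds.inner ((hstrong (h :: l)).sub
        (((rightCreation h).continuous.tendsto _).comp (hstrong l)))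
    · simp only [inner_rightCommutator_of_isGradient (hAU _)]
      exact tendsto_const_nhds.inner hlim2
  have hdense : Dense ((Submodule.span ℂ (Set.range elemTensor) : Submodule ℂ Fock) : Set Fock) := by
    rw [Submodule.dense_iff_topologicalClosure_eq_top,
      Submodule.topologicalClosure_eq_top_iff, Submodule.eq_bot_iff]
    intro x hx
    exact eq_zero_of_inner_elemTensor x fun l =>
      (Submodule.mem_orthogonal _ _).1 hx _ (Submodule.subset_span ⟨l, rfl⟩)
  refine fun v => congrFun (Continuous.ext_on (f := fun v => inner ℂ u (rightCommutator p h v))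
    (g := fun v => inner ℂ (elemBiprocess h u (reflection v)) η) hdense ?_ ?_ fun x hx => ?_) v
  · fun_prop
  · exact ((continuous_elemBiprocess h u).comp reflection.continuous).inner continuous_const
  · have hadd : ∀ x y, elemBiprocess h u (x + y) = elemBiprocess h u x + elemBiprocess h u y :=
      fun x y => by
        rw [elemBiprocess, tmul_add, UniformSpace.Completion.coe_add, map_add]; rfl
    have hsmul : ∀ (c : ℂ) x, elemBiprocess h u (c • x) = c • elemBiprocess h u x :=
      fun c x => by
        rw [elemBiprocess, tmul_smul, UniformSpace.Completion.coe_smul, map_smul]; rfl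
    beta_reduce
    induction hx using Submodule.span_induction with
    | mem x hx => obtain ⟨l, rfl⟩ := hx; exact hbasic l
    | zero =>
      rw [map_zero, map_zero, inner_zero_right, ← zero_smul ℂ (0 : Fock), hsmul, zero_smul,
        inner_zero_left]
    | add x y _ _ h1 h2 =>
      rw [map_add, map_add, inner_add_right, h1, h2, hadd, inner_add_left]
    | smul c x _ h1 =>
      rw [map_smul, map_smulₛₗ, inner_smul_right, h1, hsmul, inner_smul_left, Complex.conj_conj]

/-- The biprocesses `eᵢ · fⱼ ⊗ J fₖ` are orthonormal, and their pairings with the gradient of `p`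
are the matrix entries of the commutators, so Bessel's inequality applies. -/
theorem isJointlyHilbertSchmidt_rightCommutator {ι κ : Type*} (e : HilbertBasis ι ℝ RealL2)
    (f : HilbertBasis κ ℂ Fock) {p : Fock →L[ℂ] Fock}
    (hp : ∀ y ∈ rightCommutant, Commute p y) (hD : toL2 p ∈ D12) :
    IsJointlyHilbertSchmidt f fun i => rightCommutator p (e i) := by
  classical
  obtain ⟨η, hη⟩ := exists_inner_rightCommutator_eq hp hD
  have hort : Orthonormal ℂ fun x : (ι × κ) × κ =>
      elemBiprocess (e x.1.1) (f x.2) (reflection (f x.1.2)) := by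
    rw [orthonormal_iff_ite]
    rintro ⟨⟨i, k⟩, j⟩ ⟨⟨i', k'⟩, j'⟩
    rw [inner_elemBiprocess, inner_reflection_reflection,
      orthonormal_iff_ite.1 e.orthonormal, orthonormal_iff_ite.1 f.orthonormal,
      orthonormal_iff_ite.1 f.orthonormal]
    simp only [Prod.mk.injEq, eq_comm (a := k')]
    by_cases hi : i = i' <;> by_cases hj : j = j' <;> by_cases hk : k = k' <;>
      simp [hi, hj, hk]
  have hs := hort.inner_products_summable η
  simp only [← hη] at hs
  refine ((summable_prod_of_nonneg fun x => sq_nonneg _).1 hs).2.congr fun x => ?_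
  exact (f.hasSum_norm_inner_sq (rightCommutator p (e x.1) (f x.2))).tsum_eq

/-! ### Projections and idempotents -/

/-- Both `p` and `p*` commute with `r + r*`, so `[p, r]* = -[p*, r*] = [p*, r]`. In particular the
commutators of a projection are self-adjoint. -/
theorem adjoint_rightCommutator {p : Fock →L[ℂ] Fock}
    (hp : ∀ y ∈ rightCommutant, Commute p y) (h : RealL2) :
    adjoint (rightCommutator p h) = rightCommutator (adjoint p) h := by
  have hW : adjoint (rightSemicircular h) = rightSemicircular h := adjoint_rightSemicircular h
  have h1 := Commute.star_star (hp _ (rightSemicircular_mem h))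
  rw [star_eq_adjoint, star_eq_adjoint, hW] at h1
  have h2 : adjoint p * (rightCreation h + adjoint (rightCreation h))
      = (rightCreation h + adjoint (rightCreation h)) * adjoint p := h1
  have h3 : adjoint (rightCommutator p h) = adjoint (rightCreation h) * adjoint p
      - adjoint p * adjoint (rightCreation h) := by
    simp only [rightCommutator, ← star_eq_adjoint, star_sub, star_mul]
  rw [h3, rightCommutator]
  rw [mul_add, add_mul] at h2
  rw [sub_eq_sub_iff_add_eq_add, add_comm, ← h2]

/-- A projection in the von Neumann algebra whose commutators with the right creation operators
are jointly Hilbert–Schmidt is trivial. -/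
theorem eq_zero_or_one_of_isStarProjection {ι κ : Type*} (e : HilbertBasis ι ℝ RealL2)
    (f : HilbertBasis κ ℂ Fock) {q : Fock →L[ℂ] Fock} (hq : IsStarProjection q)
    (hcomm : ∀ y ∈ rightCommutant, Commute q y)
    (hs : IsJointlyHilbertSchmidt f fun i => rightCommutator q (e i)) :
    q = 0 ∨ q = 1 := by
  obtain ⟨z, hz⟩ := (isCuntzFamily_rightCreation e).exists_norm_sq_eq_intCast f hq
    (fun i => by
      have := adjoint_rightCommutator hcomm (e i)
      rwa [show adjoint q = q from hq.isSelfAdjoint] at this) hs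
  have hle : ‖q vacuum‖ ≤ 1 := by
    have := norm_sub_apply_le_of_isStarProjection hq (IsStarProjection.zero _) vacuum
    rwa [sub_zero, norm_vacuum] at this
  have hsq : ‖q vacuum‖ ^ 2 ≤ 1 := pow_le_one₀ (norm_nonneg _) hle
  have hz0 : 0 ≤ z := by exact_mod_cast hz ▸ sq_nonneg ‖q vacuum‖
  have hz1 : z ≤ 1 := by exact_mod_cast hz ▸ hsq
  have hpyth : ‖(1 - q) vacuum‖ ^ 2 = 1 - ‖q vacuum‖ ^ 2 := by
    have h1 := hq.isSelfAdjoint.inner_sq vacuum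
    have h2 := ((IsSelfAdjoint.one _).sub hq.isSelfAdjoint).inner_sq vacuum
    rw [hq.isIdempotentElem.eq] at h1
    rw [hq.one_sub.isIdempotentElem.eq, sub_apply, inner_sub_right, h1,
      show (1 : Fock →L[ℂ] Fock) vacuum = vacuum from rfl, inner_self_eq_norm_sq_to_K,
      norm_vacuum] at h2
    exact Complex.ofReal_injective (by simpa using h2.symm)
  obtain rfl | rfl : z = 0 ∨ z = 1 := by omega
  · left
    refine eq_zero_of_apply_vacuum hcomm ?_
    simpa using hz
  · right
    have : (1 - q) = 0 := by
      refine eq_zero_of_apply_vacuum (fun y hy => (Commute.one_left y).sub_left (hcomm y hy)) ?_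
      rw [hz] at hpyth
      simpa using hpyth
    exact (sub_eq_zero.1 this).symm

/-- For `z = p + p* - 1` and `w = p* - p`, idempotence gives `z² = 1 + w* w ≥ 1`. -/
theorem norm_le_norm_add_adjoint_sub_one {p : Fock →L[ℂ] Fock} (hp : p * p = p) (x : Fock) :
    ‖x‖ ≤ ‖(p + adjoint p - 1) x‖ := by
  have hp' : adjoint p * adjoint p = adjoint p := by
    have := congrArg star hp
    rwa [star_mul, star_eq_adjoint] at this
  have hz : IsSelfAdjoint (p + adjoint p - 1) := by
    rw [IsSelfAdjoint, star_sub, star_add, star_one, star_eq_adjoint, star_eq_adjoint,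
      adjoint_adjoint, add_comm]
  have hsq : (p + adjoint p - 1) * (p + adjoint p - 1)
      = 1 + (p - adjoint p) * (adjoint p - p) := by
    simp only [mul_sub, sub_mul, mul_add, add_mul, hp, hp', mul_one, one_mul]
    abel
  have h := hz.inner_sq x
  rw [hsq, add_apply, inner_add_right, show (1 : Fock →L[ℂ] Fock) x = x from rfl,
    inner_self_eq_norm_sq_to_K] at h
  have hw : inner ℂ x (((p - adjoint p) * (adjoint p - p)) x)
      = ((‖(adjoint p - p) x‖ ^ 2 : ℝ) : ℂ) := by
    change inner ℂ x ((p - adjoint p) ((adjoint p - p) x)) = _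
    rw [← adjoint_inner_left, map_sub, adjoint_adjoint, inner_self_eq_norm_sq_to_K]
    norm_cast
  rw [hw] at h
  have h' : ‖x‖ ^ 2 + ‖(adjoint p - p) x‖ ^ 2 = ‖(p + adjoint p - 1) x‖ ^ 2 :=
    Complex.ofReal_injective (by simpa using h)
  refine (abs_le_of_sq_le_sq' ?_ (norm_nonneg _)).2
  nlinarith [sq_nonneg ‖(adjoint p - p) x‖]

theorem eq_zero_or_one_of_isIdempotentElem {p : Fock →L[ℂ] Fock} (hp : IsIdempotentElem p)
    (hcomm : ∀ y ∈ rightCommutant, Commute p y) (hD : toL2 p ∈ D12) : p = 0 ∨ p = 1 := by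
  obtain ⟨w, e, -⟩ := exists_hilbertBasis ℝ RealL2
  obtain ⟨w', f, -⟩ := exists_hilbertBasis ℂ Fock
  have hs := isJointlyHilbertSchmidt_rightCommutator e f hcomm hD
  -- The range of `p`, written as a kernel so that it is visibly closed.
  set K : Submodule ℂ Fock := (1 - p).ker with hK
  have hmem : ∀ x, x ∈ K ↔ p x = x := fun x => by
    rw [hK, LinearMap.mem_ker]
    change x - p x = 0 ↔ _
    rw [sub_eq_zero, eq_comm]
  have hKc : CompleteSpace K := (1 - p).isClosed_ker.completeSpace_coe
  set q := K.starProjection with hqdef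
  have hq : IsStarProjection q := isStarProjection_starProjection
  have hpq : p * q = q := by
    ext1 x
    exact (hmem _).1 (Submodule.starProjection_apply_mem K x)
  have hqp : q * p = p := by
    ext1 x
    exact Submodule.starProjection_eq_self_iff.2
      ((hmem _).2 (congrArg (fun T : Fock →L[ℂ] Fock => T x) hp.eq))
  -- The commutant preserves the range of `p` and is closed under adjoints, so the range projection
  -- commutes with it.
  have hqcomm : ∀ y ∈ rightCommutant, Commute q y := by
    have hinv : ∀ y ∈ rightCommutant, q * y * q = y * q := fun y hy => by
      ext1 x
      refine Submodule.starProjection_eq_self_iff.2 ((hmem _).2 ?_)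
      change (p * y * q) x = (y * q) x
      rw [(hcomm y hy).eq, mul_assoc, hpq]
    intro y hy
    have h1 := congrArg star (hinv _ (star_mem hy))
    simp only [star_mul, star_star, hq.isSelfAdjoint.star_eq] at h1
    rw [← mul_assoc, hinv y hy] at h1
    exact h1.symm
  have hzq : (p + adjoint p - 1) * q = adjoint p := by
    have h1 := congrArg star hqp
    rw [star_mul, hq.isSelfAdjoint.star_eq, star_eq_adjoint] at h1
    rw [sub_mul, add_mul, hpq, h1, one_mul, add_sub_cancel_left]
  have hsa : IsJointlyHilbertSchmidt f fun i => rightCommutator (adjoint p) (e i) := by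
    simpa only [adjoint_rightCommutator hcomm] using hs.adjoint'
  -- Commuting `z q = p*` with `r`, where `z = p + p* - 1`, gives `z [q, r] = [p*, r] - [z, r] q`.
  -- The lower bound on `z` then removes it from the left side.
  have hqs : IsJointlyHilbertSchmidt f fun i => rightCommutator q (e i) := by
    refine (hsa.add ((hs.add hsa).mul_right (-q))).of_norm_le 1 fun i x => ?_
    have hid : (p + adjoint p - 1) * rightCommutator q (e i) = rightCommutator (adjoint p) (e i)
        + (rightCommutator p (e i) + rightCommutator (adjoint p) (e i)) * (-q) := by
      have h1 : (p + adjoint p - 1) * rightCommutator q (e i)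
          = (p + adjoint p - 1) * q * rightCreation (e i)
            - (p + adjoint p - 1) * rightCreation (e i) * q := by
        simp only [rightCommutator, mul_sub, mul_assoc]
      have h2 : rightCommutator (adjoint p) (e i) = adjoint p * rightCreation (e i)
          - rightCreation (e i) * ((p + adjoint p - 1) * q) := by rw [hzq]; rfl
      rw [h1, hzq]
      nth_rewrite 1 [h2]
      simp only [rightCommutator, mul_sub, sub_mul, mul_add, add_mul, mul_neg, one_mul, mul_assoc]
      abel
    rw [one_mul, ← hid]
    exact norm_le_norm_add_adjoint_sub_one hp.eq _
  rcases eq_zero_or_one_of_isStarProjection e f hq hqcomm hqs with h0 | h1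
  · left; rw [← hqp, h0, zero_mul]
  · right; rw [← hpq.trans h1, h1, mul_one]

theorem vacuum_mem_D12 : vacuum ∈ D12 :=
  ⟨0, subset_closure ⟨1, 0, IsGradient.one, by rw [map_zero]; rfl⟩⟩

theorem zero_mem_D12 : (0 : Fock) ∈ D12 :=
  ⟨0, subset_closure ⟨(0 : ℂ) • 1, (0 : ℂ) • 0, IsGradient.one.smul 0, by
    rw [zero_smul, zero_smul, map_zero]; rfl⟩⟩

end

end WignerSpace

theorem mainTheorem5 :
    (∀ p ∈ WignerSpace.freeBrownianVN, IsStarProjection p →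
      (WignerSpace.toL2 p ∈ WignerSpace.D12 ↔ p = 0 ∨ p = 1)) ∧
    (∀ p ∈ WignerSpace.freeBrownianVN, IsIdempotentElem p →
      (WignerSpace.toL2 p ∈ WignerSpace.D12 ↔ p = 0 ∨ p = 1)) := by
  have h : ∀ p ∈ WignerSpace.freeBrownianVN, IsIdempotentElem p →
      (WignerSpace.toL2 p ∈ WignerSpace.D12 ↔ p = 0 ∨ p = 1) := by
    refine fun p hp hidem => ⟨fun hD => ?_, ?_⟩
    · exact WignerSpace.eq_zero_or_one_of_isIdempotentElem hidem
        (fun y hy => WignerSpace.commute_of_mem_freeBrownianVN hp hy) hD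
    · rintro (rfl | rfl)
      · rw [map_zero]; exact WignerSpace.zero_mem_D12
      · exact WignerSpace.vacuum_mem_D12
  exact ⟨fun p hp hproj => h p hp hproj.isIdempotentElem, h⟩
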